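/- A bordered triangulated surface $(S,T)$ is a compact connected surface $S$ with nonempty boundary together with a triangulation $T$, obtained by gluing sides of finitely many triangles in pairs. Let $E$ be its set of edges. An edge is a boundary edge if it lies in $\partial S$, that is, if exactly one side of a triangle lies on it; otherwise two sides of triangles lie on it, and it is an interior edge. Let $\mathrm{K}^2$ be $\mathbb{E}^2$, $\mathbb{H}^2$ or $\mathbb{S}^2$. A $\mathrm{K}^2$ polyhedral metric on $(S,T)$ is a metric in which every triangle of $T$ is isometric to a (nondegenerate) $\mathrm{K}^2$ triangle. It is identified with its edge length function $d:E\to\mathbb{R}_{+}$: for every triangle of $T$ the lengths $l_1,l_2,l_3$ of its sides satisfy the strict triangle inequalities and, if $\mathrm{K}^2=\mathbb{S}^2$, also $l_i<\pi$ and $l_1+l_2+l_3<2\pi$. The boundary value of $d$ is its restriction to the set of boundary edges. For $h\in\mathbb{R}$ and an interior edge $e$, let $a,a'$ be the two inner angles facing $e$ in the triangles on its two sides, and let $b,c$ and $b',c'$ be the inner angles of these triangles adjacent to $e$. Put $$\phi_h(e)=\int_a^{\pi/2}\sin^h t\,dt+\int_{a'}^{\pi/2}\sin^h t\,dt,$$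 $$\psi_h(e)=\int_0^{(b+c-a)/2}\cos^h t\,dt+\int_0^{(b'+c'-a')/2}\cos^h t\,dt.$$ **Theorem.** Let $(S,T)$ be a bordered triangulated surface and let $h\in\mathbb{R}$. (a) If two Euclidean polyhedral metrics $d_1,d_2$ on $(S,T)$ have the same boundary value and either the same $\phi_h$-curvature on all interior edges or the same $\psi_h$-curvature on all interior edges, then $d_1=d_2$. (b) If two hyperbolic polyhedral metrics $d_1,d_2$ on $(S,T)$ have the same boundary value and the same $\psi_h$-curvature on all interior edges, then $d_1=d_2$. (c) If two spherical polyhedral metrics $d_1,d_2$ on $(S,T)$ have the same boundary value and the same $\phi_h$-curvature on all interior edges, then $d_1=d_2$. Here $d_1=d_2$ is equality of edge lengths; that is, the polyhedral metric is determined up to isometry (by an isometry carrying each triangle to itself). -/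

import Mathlib

/-- The three model plane geometries `𝔼²`, `ℍ²`, `𝕊²`. -/
inductive PlaneGeometry
  | euclidean
  | hyperbolic
  | spherical

namespace PlaneGeometry

/-- `l 0, l 1, l 2` are the side lengths of a (nondegenerate) triangle in the geometry:
positive numbers satisfying the strict triangle inequalities and, in the spherical case,
also `l i < π` and `l 0 + l 1 + l 2 < 2π`. -/
def IsTriangle (K : PlaneGeometry) (l : Fin 3 → ℝ) : Prop :=
  (∀ i, 0 < l i) ∧ (∀ i, l i < l (i + 1) + l (i + 2)) ∧
    match K with
    | euclidean => True
    | hyperbolic => True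
    | spherical => (∀ i, l i < Real.pi) ∧ l 0 + l 1 + l 2 < 2 * Real.pi

/-- The inner angle facing the side of length `l i` in the triangle with side lengths
`l 0, l 1, l 2`, as given by the cosine law of the geometry. -/
noncomputable def angle (K : PlaneGeometry) (l : Fin 3 → ℝ) (i : Fin 3) : ℝ :=
  match K with
  | euclidean =>
      Real.arccos ((l (i + 1) ^ 2 + l (i + 2) ^ 2 - l i ^ 2) / (2 * l (i + 1) * l (i + 2)))
  | hyperbolic =>
      Real.arccos ((Real.cosh (l (i + 1)) * Real.cosh (l (i + 2)) - Real.cosh (l i)) /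
        (Real.sinh (l (i + 1)) * Real.sinh (l (i + 2))))
  | spherical =>
      Real.arccos ((Real.cos (l i) - Real.cos (l (i + 1)) * Real.cos (l (i + 2))) /
        (Real.sin (l (i + 1)) * Real.sin (l (i + 2))))

end PlaneGeometry

/-- A bordered triangulated surface: a compact connected surface with nonempty boundary, obtained
from a finite disjoint union of triangles, indexed by `F`, by identifying some of their sides in
pairs. The pair `(t, i)` is the side of the triangle `t` opposite to its `i`-th vertex, that is, the
side with end vertices `i + 1` and `i + 2`. `E` is the set of edges of the resulting triangulation.
(Two sides of one and the same triangle may be glued, and a quotient need not be a simplicial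
complex; ordinary simplicial triangulations are a special case.) -/
structure BorderedTriangulatedSurface (F E : Type*) [Fintype F] [DecidableEq E] where
  /-- The edge of the triangulation onto which a side of a triangle is mapped. -/
  edge : F × Fin 3 → E
  /-- Each edge carries a reference direction; this says whether it is the direction of the side
  `(t, i)` from vertex `i + 1` to vertex `i + 2`. Sides on a common edge are glued by the
  identification that respects the direction of the edge. -/
  agrees : F × Fin 3 → Bool
  /-- Every edge is the image of a side. -/
  edge_surjective : Function.Surjective edge
  /-- Sides are glued at most in pairs. -/
  card_sides_le_two : ∀ e, (Finset.univ.filter fun s => edge s = e).card ≤ 2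
  /-- The surface is connected: any two triangles are joined by a chain of triangles in which
  consecutive ones share an edge. -/
  connected : ∀ t t' : F,
    Relation.ReflTransGen (fun t₁ t₂ => ∃ i j, edge (t₁, i) = edge (t₂, j)) t t'
  /-- The boundary is nonempty: some edge lies on only one side. -/
  exists_boundary : ∃ e, (Finset.univ.filter fun s => edge s = e).card = 1

namespace BorderedTriangulatedSurface

variable {F E : Type*} [Fintype F] [DecidableEq E]

/-- The sides of triangles that are mapped onto the edge `e`. -/
def sides (S : BorderedTriangulatedSurface F E) (e : E) : Finset (F × Fin 3) :=
  Finset.univ.filter fun s => S.edge s = e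

/-- Boundary edges: only one side of a triangle lies on them. -/
def IsBoundaryEdge (S : BorderedTriangulatedSurface F E) (e : E) : Prop :=
  (S.sides e).card = 1

/-- Interior edges: all edges that are not boundary edges, so that two sides lie on them. -/
def IsInteriorEdge (S : BorderedTriangulatedSurface F E) (e : E) : Prop :=
  ¬ S.IsBoundaryEdge e

/-- The lengths of the three sides of the triangle `t`, for edge lengths `d`. -/
def sideLengths (S : BorderedTriangulatedSurface F E) (d : E → ℝ) (t : F) : Fin 3 → ℝ :=
  fun i => d (S.edge (t, i))

/-- A polyhedral metric, given by its edge lengths `d : E → ℝ`: on every triangle they are the side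
lengths of a triangle in the geometry `K`. -/
def IsPolyhedralMetric (S : BorderedTriangulatedSurface F E) (K : PlaneGeometry)
    (d : E → ℝ) : Prop :=
  ∀ t, K.IsTriangle (S.sideLengths d t)

/-- The inner angle of the triangle `t` at its vertex `i`, facing the side `(t, i)`. -/
noncomputable def innerAngle (S : BorderedTriangulatedSurface F E) (K : PlaneGeometry)
    (d : E → ℝ) (t : F) (i : Fin 3) : ℝ :=
  K.angle (S.sideLengths d t) i

/-- The `φ_h`-curvature of an edge: the sum over the sides on it of
`∫_a^{π/2} sin^h t dt`, where `a` is the inner angle facing the side. -/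
noncomputable def phiCurvature (S : BorderedTriangulatedSurface F E) (K : PlaneGeometry) (h : ℝ)
    (d : E → ℝ) (e : E) : ℝ :=
  ∑ s ∈ S.sides e, ∫ x in (S.innerAngle K d s.1 s.2)..(Real.pi / 2), Real.sin x ^ h

/-- The `ψ_h`-curvature of an edge: the sum over the sides on it of
`∫_0^{(b+c-a)/2} cos^h t dt`, where `a` is the inner angle facing the side and `b`, `c` are the
two inner angles adjacent to it. -/
noncomputable def psiCurvature (S : BorderedTriangulatedSurface F E) (K : PlaneGeometry) (h : ℝ)
    (d : E → ℝ) (e : E) : ℝ :=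
  ∑ s ∈ S.sides e,
    ∫ x in (0 : ℝ)..((S.innerAngle K d s.1 (s.2 + 1) + S.innerAngle K d s.1 (s.2 + 2)
      - S.innerAngle K d s.1 s.2) / 2), Real.cos x ^ h

end BorderedTriangulatedSurface

/-! In each geometry a side of length l_i is given an angle α_i and a positive function `f` of
length with a sine law sin α_i = k f(l_i), where k is common to the three sides. In the Euclidean
and spherical cases α_i is the facing angle and f(t) is t or sin t. In the hyperbolic case α_i is
`coangle`, that is π/2 - (b+c-a)/2, and f(t) = tanh(t/2). With Φ = `sinPowIntegral h`, the curvature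
in question is the sum of Φ(α) over the sides on an edge.

Use u_i = ∫ f^(-h-1) as coordinate instead of l_i. Along a path put z_i = f(l_i)^h u_i', so that
l_i' = f(l_i) z_i. The sine law then gives Σ Φ(α_i)' u_i' = -k^h Σ α_i' z_i, and Σ α_i' z_i is a
nonnegative quadratic form in z. Hence for two triangles the sum of (difference of Φ(α_i)) times
(difference of u_i) is at most 0. Summed over all triangles and regrouped by edges, the total is 0:
on a boundary edge u does not change, on an interior edge the curvature does not. So every triangle
gives equality, and its initial z lies in the kernel of the form. This kernel is 0 in the spherical
and hyperbolic cases. In the Euclidean case it consists of scalings, and the scale factor is 1 by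
connectedness and the boundary value.

The difficulty is that a segment in the u coordinates may leave the set of nondegenerate triples. If
h > -1, then Φ is continuous on [0, π], and the angles extend continuously by the values 0 and π.
The monotone quantity takes only finitely many values on degenerate triples, which cannot spoil
monotonicity (`antitoneOn_of_finite_image_diff`). If h ≤ -1, the segment does not leave the set, by
a Minkowski-type inequality (`lt_add_of_path`). -/

open Set Filter Topology

/-! ### Real-variable lemmas on paths and monotonicity -/

/-- A path from `x` to `y` along which the primitive of `w` grows at constant speed. -/
theorem exists_path_of_weight {w : ℝ → ℝ} {x y : ℝ} (hw : ContinuousOn w (uIcc x y))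
    (hpos : ∀ t ∈ uIcc x y, 0 < w t) :
    ∃ l : ℝ → ℝ, l 0 = x ∧ l 1 = y ∧ ∀ s ∈ Icc (0 : ℝ) 1, l s ∈ uIcc x y ∧
      HasDerivAt l ((∫ t in x..y, w t) / w (l s)) s := by
  have hle : min x y ≤ max x y := min_le_max
  -- Constant extension of `w` beyond the interval keeps it above a positive constant, so its
  -- primitive is a bijection of ℝ whose inverse gives the path.
  let W : ℝ → ℝ := fun t => w (projIcc _ _ hle t)
  have hWc : Continuous W :=
    hw.comp_continuous (continuous_subtype_val.comp continuous_projIcc) fun t => (projIcc _ _ hle t).2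
  have hWeq : ∀ t ∈ uIcc x y, W t = w t := fun t ht => by
    simp only [W]; rw [projIcc_of_mem hle ht]
  obtain ⟨t₀, ht₀, hmin⟩ := isCompact_uIcc.exists_isMinOn (s := uIcc x y) nonempty_uIcc hw
  have hWge : ∀ t, w t₀ ≤ W t := fun t => hmin (projIcc _ _ hle t).2
  have hc : 0 < w t₀ := hpos _ ht₀
  have hWpos : ∀ t, 0 < W t := fun t => hc.trans_le (hWge t)
  let U : ℝ → ℝ := fun t => ∫ r in x..t, W r
  have hU : ∀ t, HasDerivAt U (W t) t := fun t => (hWc.integral_hasStrictDerivAt x t).hasDerivAt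
  have hUmono : StrictMono U := strictMono_of_deriv_pos fun t => by rw [(hU t).deriv]; exact hWpos t
  have hUx : U x = 0 := by simp [U]
  have hUcont : Continuous U := continuous_iff_continuousAt.2 fun t => (hU t).continuousAt
  have hlin : Monotone fun t => U t - w t₀ * t := by
    apply monotone_of_deriv_nonneg
    · intro t
      exact ((hU t).sub ((hasDerivAt_id t).const_mul (w t₀))).differentiableAt
    · intro t
      have h := (hU t).sub ((hasDerivAt_id t).const_mul (w t₀))
      rw [mul_one] at h
      exact (sub_nonneg.2 (hWge t)).trans_eq h.deriv.symm
  have hsurj : Function.Surjective U := by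
    apply hUcont.surjective
    · apply tendsto_atTop_mono' atTop (f₁ := fun t => w t₀ * t + (U 0 - w t₀ * 0))
      · filter_upwards [eventually_ge_atTop 0] with t ht
        have := hlin ht
        simp only at this; linarith
      · exact tendsto_atTop_add_const_right _ _ (tendsto_id.const_mul_atTop hc)
    · apply tendsto_atBot_mono' atBot (f₁ := fun t => w t₀ * t + (U 0 - w t₀ * 0))
      · filter_upwards [eventually_le_atBot 0] with t ht
        have := hlin ht
        simp only at this; linarith
      · exact tendsto_atBot_add_const_right _ _ (tendsto_id.const_mul_atBot hc)
  let e := hUmono.orderIsoOfSurjective U hsurj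
  have heU : ∀ t, e.symm (U t) = t := fun t => e.symm_apply_apply t
  have hUe : ∀ r, U (e.symm r) = r := fun r => e.apply_symm_apply r
  have hV : ∀ r, HasDerivAt e.symm (W (e.symm r))⁻¹ r := fun r =>
    HasDerivAt.of_local_left_inverse e.symm.continuous.continuousAt (hU _) (hWpos _).ne'
      (Eventually.of_forall hUe)
  have hUy : U y = ∫ t in x..y, w t := intervalIntegral.integral_congr hWeq
  refine ⟨fun s => e.symm (s * U y), ?_, ?_, fun s hs => ?_⟩
  · simp only [zero_mul]; rw [← hUx, heU]
  · simp only [one_mul]; rw [heU]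
  · have hmem : e.symm (s * U y) ∈ uIcc x y := by
      have h1 : s * U y ∈ uIcc (U x) (U y) := by
        rw [hUx, mem_uIcc]
        rcases le_total 0 (U y) with h | h
        · left; exact ⟨mul_nonneg hs.1 h, mul_le_of_le_one_left h hs.2⟩
        · right; exact ⟨by nlinarith [hs.1, hs.2], mul_nonpos_of_nonneg_of_nonpos hs.1 h⟩
      have h2 := e.symm.monotone.mapsTo_uIcc h1
      rwa [heU, heU] at h2
    refine ⟨hmem, ?_⟩
    have h3 := (hV (s * U y)).comp s ((hasDerivAt_id s).mul_const (U y))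
    rw [hWeq _ hmem] at h3
    refine h3.congr_deriv ?_
    rw [one_mul, ← hUy, div_eq_inv_mul]

/-- A function on an interval is antitone if it is differentiable with nonpositive derivative at
the points of an open set outside of which it takes only finitely many values. -/
theorem antitoneOn_of_finite_image_diff {g : ℝ → ℝ} {D : Set ℝ} {a b : ℝ}
    (hg : ContinuousOn g (Icc a b)) (hD : ∀ s ∈ Icc a b, s ∈ D → D ∈ 𝓝 s)
    (hd : ∀ s ∈ Icc a b, s ∈ D → ∃ g', g' ≤ 0 ∧ HasDerivAt g g' s)
    (hfin : (g '' (Icc a b \ D)).Finite) : AntitoneOn g (Icc a b) := by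
  intro s hs t ht hst
  by_contra! hlt
  have hst' : s < t := lt_of_le_of_ne hst fun h => by simp [h] at hlt
  -- `c` is a level that `g` does not take outside `D`. At the last time with `g ≤ c` the value is
  -- `c`, so this time lies in `D`, and `g` does not increase just after it: a contradiction.
  obtain ⟨c, hc, hcfin⟩ := ((Ioo_infinite hlt).sdiff hfin).nonempty
  have hsub : Icc s t ⊆ Icc a b := Icc_subset_Icc hs.1 ht.2
  have hgst := hg.mono hsub
  have hcomp : IsCompact (Icc s t ∩ g ⁻¹' Iic c) :=
    isCompact_Icc.of_isClosed_subset (hgst.preimage_isClosed_of_isClosed isClosed_Icc isClosed_Iic)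
      inter_subset_left
  obtain ⟨r, ⟨hr, hrc⟩, hmax⟩ := hcomp.exists_isGreatest ⟨s, ⟨le_rfl, hst⟩, hc.1.le⟩
  obtain ⟨r', hr', hgr'⟩ := intermediate_value_Icc hr.2
    (hgst.mono (Icc_subset_Icc_left hr.1)) ⟨hrc, hc.2.le⟩
  have hrr : r' = r := le_antisymm (hmax ⟨⟨hr.1.trans hr'.1, hr'.2⟩, hgr'.le⟩) hr'.1
  subst hrr
  have hrt : r' < t := lt_of_le_of_ne hr.2 fun h => by rw [h] at hgr'; exact hc.2.ne' hgr'
  have hrD : r' ∈ D := by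
    by_contra h
    exact hcfin ⟨r', ⟨hsub hr, h⟩, hgr'⟩
  obtain ⟨ε, hε, hball⟩ := Metric.mem_nhds_iff.1 (hD r' (hsub hr) hrD)
  obtain ⟨q, hq1, hq2⟩ := exists_between (lt_min hrt (lt_add_of_pos_right r' hε))
  have hqt := (lt_min_iff.1 hq2).1
  have hqD : Icc r' q ⊆ D := fun z hz => hball <| by
    rw [Metric.mem_ball, Real.dist_eq, abs_lt]
    have := (lt_min_iff.1 hq2).2
    constructor <;> linarith [hz.1, hz.2]
  have hqs : Icc r' q ⊆ Icc s t := Icc_subset_Icc hr.1 hqt.le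
  have hanti : AntitoneOn g (Icc r' q) := by
    refine antitoneOn_of_deriv_nonpos (convex_Icc _ _) (hgst.mono hqs) (fun z hz => ?_)
      fun z hz => ?_ <;>
    · have hz' := interior_subset hz
      obtain ⟨g', hg', hgd⟩ := hd z (hsub (hqs hz')) (hqD hz')
      first
      | exact hgd.differentiableAt.differentiableWithinAt
      | rw [hgd.deriv]; exact hg'
  have h1 := hanti ⟨le_rfl, hq1.le⟩ ⟨hq1.le, le_rfl⟩ hq1.le
  exact absurd (hmax ⟨hqs ⟨hq1.le, le_rfl⟩, h1.trans hrc⟩) (not_le.2 hq1)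

/-- A path that starts below the level `M` stays below it until it reaches it. -/
theorem exists_first_hit {m : ℝ → ℝ} {s b M : ℝ} (hsb : s ≤ b) (hm : ContinuousOn m (Icc s b))
    (hs : m s < M) : ∃ r ∈ Icc s b, (∀ t ∈ Icc s r, m t ≤ M) ∧ (r = b ∨ m r = M) := by
  by_cases hall : ∀ t ∈ Icc s b, m t ≤ M
  · exact ⟨b, ⟨hsb, le_rfl⟩, hall, Or.inl rfl⟩
  push Not at hall
  obtain ⟨t, ht, htM⟩ := hall
  have hcomp : IsCompact (Icc s b ∩ m ⁻¹' Ici M) :=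
    isCompact_Icc.of_isClosed_subset (hm.preimage_isClosed_of_isClosed isClosed_Icc isClosed_Ici)
      inter_subset_left
  obtain ⟨r, ⟨hr, hrM⟩, hmin⟩ := hcomp.exists_isLeast ⟨t, ht, htM.le⟩
  obtain ⟨r', hr', hmr'⟩ := intermediate_value_Icc hr.1
    (hm.mono (Icc_subset_Icc_right hr.2)) ⟨hs.le, hrM⟩
  have hrr : r' = r :=
    le_antisymm hr'.2 (hmin ⟨⟨hr'.1, hr'.2.trans hr.2⟩, hmr'.ge⟩)
  subst hrr
  refine ⟨r', hr, fun z hz => ?_, Or.inr hmr'⟩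
  by_contra! hzM
  have := hmin ⟨⟨hz.1, hz.2.trans hr.2⟩, hzM.le⟩
  rw [le_antisymm hz.2 this] at hzM
  exact hzM.ne' hmr'

/-! ### The primitive of sin^h -/

/-- The integral `∫_a^{π/2} sin^h`. -/
noncomputable def sinPowIntegral (h a : ℝ) : ℝ := ∫ x in a..(Real.pi / 2), Real.sin x ^ h

theorem continuousOn_sin_rpow (h : ℝ) :
    ContinuousOn (fun x => Real.sin x ^ h) (Ioo 0 Real.pi) := fun _ hx =>
  (Real.continuous_sin.continuousAt.rpow_const
    (Or.inl (Real.sin_pos_of_pos_of_lt_pi hx.1 hx.2).ne')).continuousWithinAt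

theorem hasDerivAt_sinPowIntegral (h : ℝ) {a : ℝ} (ha : a ∈ Ioo 0 Real.pi) :
    HasDerivAt (sinPowIntegral h) (-Real.sin a ^ h) a := by
  have hhalf : Real.pi / 2 ∈ Ioo 0 Real.pi := ⟨by positivity, by linarith [Real.pi_pos]⟩
  have hsub : uIcc a (Real.pi / 2) ⊆ Ioo 0 Real.pi := ordConnected_Ioo.uIcc_subset ha hhalf
  have hc := continuousOn_sin_rpow h
  exact intervalIntegral.integral_hasDerivAt_left (hc.mono hsub).intervalIntegrable
    (hc.stronglyMeasurableAtFilter isOpen_Ioo a ha) (hc.continuousAt (isOpen_Ioo.mem_nhds ha))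

/-- For negative `h`, Jordan's inequality 2x/π ≤ sin x bounds the integrand by a multiple of x^h,
which is integrable because h > -1. -/
theorem intervalIntegrable_sin_rpow_half {h : ℝ} (hh : -1 < h) :
    IntervalIntegrable (fun x => Real.sin x ^ h) MeasureTheory.volume 0 (Real.pi / 2) := by
  rcases le_or_gt 0 h with h0 | h0
  · exact (Real.continuous_sin.rpow_const fun _ => Or.inr h0).intervalIntegrable _ _
  have hpi := Real.pi_pos
  have h1 : IntervalIntegrable (fun x => (2 / Real.pi) ^ h * x ^ h) MeasureTheory.volume 0
      (Real.pi / 2) := (intervalIntegral.intervalIntegrable_rpow' hh).const_mul _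
  refine h1.mono_fun ?_ ?_
  · exact (Real.measurable_sin.pow_const h).aestronglyMeasurable
  · refine (MeasureTheory.ae_restrict_mem measurableSet_uIoc).mono fun x hx => ?_
    rw [uIoc_of_le (by positivity)] at hx
    have hs : 2 / Real.pi * x ≤ Real.sin x := Real.mul_le_sin hx.1.le hx.2
    have hp : 0 < 2 / Real.pi * x := mul_pos (by positivity) hx.1
    simp only
    rw [← Real.mul_rpow (by positivity) hx.1.le,
      Real.norm_of_nonneg (Real.rpow_nonneg (hp.le.trans hs) _),
      Real.norm_of_nonneg (Real.rpow_nonneg hp.le _)]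
    exact Real.rpow_le_rpow_of_nonpos hp hs h0.le

theorem intervalIntegrable_sin_rpow {h : ℝ} (hh : -1 < h) :
    IntervalIntegrable (fun x => Real.sin x ^ h) MeasureTheory.volume 0 Real.pi := by
  have h1 := intervalIntegrable_sin_rpow_half hh
  refine h1.trans ?_
  have h2 := h1.comp_sub_left Real.pi
  simp only [Real.sin_pi_sub, sub_zero] at h2
  rw [show Real.pi - Real.pi / 2 = Real.pi / 2 by ring] at h2
  exact h2.symm

theorem continuousOn_sinPowIntegral {h : ℝ} (hh : -1 < h) :
    ContinuousOn (sinPowIntegral h) (Icc 0 Real.pi) := by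
  have hpi := Real.pi_pos
  have h1 := intervalIntegrable_sin_rpow hh
  have h2 := intervalIntegral.continuousOn_primitive_interval' h1
    (a := Real.pi / 2) (by rw [uIcc_of_le hpi.le]; constructor <;> linarith)
  rw [uIcc_of_le hpi.le] at h2
  refine h2.neg.congr fun x _ => ?_
  exact intervalIntegral.integral_symm _ _

theorem integral_cos_rpow_eq_sinPowIntegral (h θ : ℝ) :
    ∫ x in (0 : ℝ)..θ, Real.cos x ^ h = sinPowIntegral h (Real.pi / 2 - θ) := by
  have := intervalIntegral.integral_comp_sub_left (a := 0) (b := θ)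
    (fun x => Real.sin x ^ h) (Real.pi / 2)
  simp only [Real.sin_pi_div_two_sub, sub_zero] at this
  exact this

/-! ### Convexity of the triangle inequality along paths -/

/-- Minkowski-type inequality: along paths on which the primitives of `f ^ p` grow at constant
speed, the strict inequality `c < a + b` persists if it holds at both ends. -/
theorem lt_add_of_path {I : Set ℝ} {f f' : ℝ → ℝ} (hI : I.OrdConnected) (hIo : IsOpen I)
    (hI0 : I ⊆ Ioi 0) (hf : ∀ t ∈ I, HasDerivAt f (f' t) t) (hpos : ∀ t ∈ I, 0 < f t)
    (hκ : ∀ a ∈ I, ∀ b ∈ I, a + b ∈ I → ∀ x y : ℝ,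
      f' (a + b) / f (a + b) * (x + y) ^ 2 ≤ f' a / f a * x ^ 2 + f' b / f b * y ^ 2)
    {p : ℝ} (hp : 0 ≤ p) {a b c : ℝ → ℝ} {u v w : ℝ}
    (ha : ∀ s ∈ Icc (0 : ℝ) 1, a s ∈ I ∧ HasDerivAt a (u * f (a s) ^ (-p)) s)
    (hb : ∀ s ∈ Icc (0 : ℝ) 1, b s ∈ I ∧ HasDerivAt b (v * f (b s) ^ (-p)) s)
    (hc : ∀ s ∈ Icc (0 : ℝ) 1, c s ∈ I ∧ HasDerivAt c (w * f (c s) ^ (-p)) s)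
    (h0 : c 0 < a 0 + b 0) (h1 : c 1 < a 1 + b 1) :
    ∀ s ∈ Icc (0 : ℝ) 1, c s < a s + b s := by
  intro s hs
  by_contra! hle
  have hac : ∀ t ∈ Icc (0 : ℝ) 1, ContinuousAt a t := fun t ht => (ha t ht).2.continuousAt
  have hbc : ∀ t ∈ Icc (0 : ℝ) 1, ContinuousAt b t := fun t ht => (hb t ht).2.continuousAt
  have hcc : ∀ t ∈ Icc (0 : ℝ) 1, ContinuousAt c t := fun t ht => (hc t ht).2.continuousAt
  -- an upper level `M ∈ I` strictly above `c`
  obtain ⟨r₀, hr₀, hmax⟩ := isCompact_Icc.exists_isMaxOn (s := Icc (0 : ℝ) 1) ⟨s, hs⟩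
    (f := c) fun t ht => (hcc t ht).continuousWithinAt
  obtain ⟨M, hM, hMI⟩ : ∃ M, c r₀ < M ∧ M ∈ I :=
    ((Eventually.filter_mono nhdsWithin_le_nhds (hIo.mem_nhds (hc r₀ hr₀).1) :
      ∀ᶠ z in 𝓝[>] c r₀, z ∈ I).and self_mem_nhdsWithin).exists.imp fun z hz => ⟨hz.2, hz.1⟩
  have hcM : ∀ t ∈ Icc (0 : ℝ) 1, c t < M := fun t ht => (hmax ht).trans_lt hM
  have hmM : a s + b s < M := hle.trans_lt (hcM s hs)
  -- `a + b` may leave `I`, as when it exceeds π on the sphere. It is followed from `s` forward, and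
  -- below backward by time reversal, only while it stays at most `M`. Each end of the resulting
  -- interval is either an end of [0, 1], where the strict inequality is assumed, or a time with a +
  -- b = M > c.
  obtain ⟨β, hβ, hβM, hβe⟩ := exists_first_hit (m := fun t => a t + b t) hs.2
    (fun t ht => ((hac t ⟨hs.1.trans ht.1, ht.2⟩).add
      (hbc t ⟨hs.1.trans ht.1, ht.2⟩)).continuousWithinAt) hmM
  obtain ⟨γ, hγ, hγM, hγe⟩ := exists_first_hit (m := fun t => a (-t) + b (-t)) (s := -s) (b := 0)
    (by linarith [hs.1])
    (fun t ht => by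
      have ht' : -t ∈ Icc (0 : ℝ) 1 := ⟨by linarith [ht.2], by linarith [ht.1, hs.2]⟩
      exact (((hac _ ht').comp continuous_neg.continuousAt).add
        ((hbc _ ht').comp continuous_neg.continuousAt)).continuousWithinAt) (by simpa using hmM)
  set α := -γ with hα
  have hαs : α ≤ s := by linarith [hγ.1]
  have hα0 : 0 ≤ α := by linarith [hγ.2]
  have hsub : Icc α β ⊆ Icc 0 1 := Icc_subset_Icc hα0 hβ.2
  have hmI : ∀ t ∈ Icc α β, a t + b t ∈ I := by
    intro t ht
    have h01 := hsub ht
    refine hI.out (ha t h01).1 hMI ⟨by linarith [mem_Ioi.1 (hI0 (hb t h01).1)], ?_⟩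
    rcases le_total s t with hst | hst
    · exact hβM t ⟨hst, ht.2⟩
    · have := hγM (-t) ⟨by linarith, by linarith [ht.1]⟩
      simpa using this
  have hβlt : c β < a β + b β := by
    rcases hβe with h | h
    · rw [h]; exact h1
    · rw [h]; exact hcM β ⟨hs.1.trans hβ.1, hβ.2⟩
  have hαlt : c α < a α + b α := by
    rcases hγe with h | h
    · rw [hα, h, neg_zero]; exact h0
    · rw [hα, h]; exact hcM (-γ) ⟨hα0, hαs.trans hs.2⟩
  -- the primitive of `f ^ p`
  have hfp : ContinuousOn (fun t => f t ^ p) I := fun t ht =>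
    ((hf t ht).continuousAt.rpow_const (Or.inl (hpos t ht).ne')).continuousWithinAt
  let U : ℝ → ℝ := fun t => ∫ r in M..t, f r ^ p
  have hU : ∀ t ∈ I, HasDerivAt U (f t ^ p) t := fun t ht =>
    intervalIntegral.integral_hasDerivAt_right
      (hfp.mono (hI.uIcc_subset hMI ht)).intervalIntegrable
      (hfp.stronglyMeasurableAtFilter hIo t ht) (hfp.continuousAt (hIo.mem_nhds ht))
  have hUmono : StrictMonoOn U I := by
    refine strictMonoOn_of_deriv_pos hI.convex (fun t ht => (hU t ht).continuousAt.continuousWithinAt)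
      fun t ht => ?_
    rw [(hU t (interior_subset ht)).deriv]
    exact Real.rpow_pos_of_pos (hpos t (interior_subset ht)) _
  -- `U (c t)` is affine in `t`, so the second derivative of `δ` comes from `a + b` alone, and `hκ`
  -- makes it nonpositive. A concave function positive at both ends is positive between them.
  let δ : ℝ → ℝ := fun t => U (a t + b t) - U (c t)
  let δ' : ℝ → ℝ := fun t =>
    f (a t + b t) ^ p * (u * f (a t) ^ (-p) + v * f (b t) ^ (-p)) - w
  have hδ : ∀ t ∈ Icc α β, HasDerivAt δ (δ' t) t := by
    intro t ht
    have h01 := hsub ht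
    have e1 := (hU _ (hmI t ht)).comp t ((ha t h01).2.add (hb t h01).2)
    have e2 := (hU _ (hc t h01).1).comp t (hc t h01).2
    refine (e1.sub e2).congr_deriv ?_
    simp only [δ', Real.rpow_neg (hpos _ (hc t h01).1).le]
    field_simp [(Real.rpow_pos_of_pos (hpos _ (hc t h01).1) p).ne']
  have hinv : ∀ (q : ℝ → ℝ) (z t : ℝ), q t ∈ I → HasDerivAt q (z * f (q t) ^ (-p)) t →
      HasDerivAt (fun t => z * f (q t) ^ (-p))
        (-p * (f' (q t) / f (q t)) * (z * f (q t) ^ (-p)) ^ 2) t := by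
    intro q z t hq hd
    have e1 := (((hf _ hq).comp t hd).rpow_const (p := -p) (Or.inl (hpos _ hq).ne')).const_mul z
    refine e1.congr_deriv ?_
    simp only [Function.comp, Real.rpow_sub_one (hpos _ hq).ne']
    ring
  have hδ2 : ∀ t ∈ Icc α β, ∃ δ'', δ'' ≤ 0 ∧ HasDerivAt δ' δ'' t := by
    intro t ht
    have h01 := hsub ht
    have hm := hmI t ht
    have e0 := ((hf _ hm).comp t ((ha t h01).2.add (hb t h01).2)).rpow_const (p := p)
      (Or.inl (hpos _ hm).ne')
    have e1 := hinv a u t (ha t h01).1 (ha t h01).2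
    have e2 := hinv b v t (hb t h01).1 (hb t h01).2
    refine ⟨_, ?_, (e0.mul (e1.add e2)).sub_const w⟩
    have hk := hκ _ (ha t h01).1 _ (hb t h01).1 hm (u * f (a t) ^ (-p)) (v * f (b t) ^ (-p))
    simp only [Function.comp, Pi.add_apply, Real.rpow_sub_one (hpos _ hm).ne']
    have hfm : 0 < f (a t + b t) ^ p := Real.rpow_pos_of_pos (hpos _ hm) _
    set X := u * f (a t) ^ (-p)
    set Y := v * f (b t) ^ (-p)
    have : 0 ≤ p * f (a t + b t) ^ p * (f' (a t) / f (a t) * X ^ 2 + f' (b t) / f (b t) * Y ^ 2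
      - f' (a t + b t) / f (a t + b t) * (X + Y) ^ 2) :=
      mul_nonneg (mul_nonneg hp hfm.le) (by linarith)
    refine le_of_eq_of_le ?_ (neg_nonpos.2 this)
    ring
  have hconc : ConcaveOn ℝ (Icc α β) δ := by
    refine AntitoneOn.concaveOn_of_deriv (convex_Icc _ _)
      (fun t ht => (hδ t ht).continuousAt.continuousWithinAt)
      (fun t ht => (hδ t (interior_subset ht)).differentiableAt.differentiableWithinAt) ?_
    have : AntitoneOn δ' (Icc α β) := by
      refine antitoneOn_of_deriv_nonpos (convex_Icc _ _)
        (fun t ht => ?_) (fun t ht => ?_) fun t ht => ?_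
      · obtain ⟨z, _, hz⟩ := hδ2 t ht
        exact hz.continuousAt.continuousWithinAt
      · obtain ⟨z, _, hz⟩ := hδ2 t (interior_subset ht)
        exact hz.differentiableAt.differentiableWithinAt
      · obtain ⟨z, hz0, hz⟩ := hδ2 t (interior_subset ht)
        rw [hz.deriv]; exact hz0
    refine (this.mono interior_subset).congr fun t ht => ?_
    exact (hδ t (interior_subset ht)).deriv.symm
  have hαβ : α ≤ β := hαs.trans hβ.1
  have hδα : 0 < δ α := sub_pos.2 <| hUmono (hc α (hsub ⟨le_rfl, hαβ⟩)).1
    (hmI α ⟨le_rfl, hαβ⟩) hαlt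
  have hδβ : 0 < δ β := sub_pos.2 <| hUmono (hc β (hsub ⟨hαβ, le_rfl⟩)).1
    (hmI β ⟨hαβ, le_rfl⟩) hβlt
  have hsI : s ∈ Icc α β := ⟨hαs, hβ.1⟩
  have hmin := hconc.min_le_of_mem_Icc ⟨le_rfl, hαβ⟩ ⟨hαβ, le_rfl⟩ hsI
  have hδs : 0 < δ s := (lt_min hδα hδβ).trans_le hmin
  have := hUmono.monotoneOn (hmI s hsI) (hc s hs).1 hle
  simp only [δ] at hδs
  linarith

/-! ### Angle models and monotonicity on one triangle -/

/-- Triples of lengths in an interval `I`, with generalized angles `α` that obey a sine law with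
respect to `f` on the open set `D` of nondegenerate triples, degenerate to `0` and `π` outside of
`D`, and whose variation is a nonnegative quadratic form with kernel in `K`. -/
structure IsAngleModel (I : Set ℝ) (f : ℝ → ℝ) (α : (Fin 3 → ℝ) → Fin 3 → ℝ)
    (D K : Set (Fin 3 → ℝ)) : Prop where
  ordConnected : I.OrdConnected
  continuousOn : ContinuousOn f I
  pos : ∀ t ∈ I, 0 < f t
  mem : ∀ l ∈ D, ∀ i, l i ∈ I
  isOpen : IsOpen D
  continuousAt_angle : ∀ l : Fin 3 → ℝ, (∀ i, l i ∈ I) → ∀ i, ContinuousAt (fun l => α l i) l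
  angle_mem : ∀ l ∈ D, ∀ i, α l i ∈ Ioo 0 Real.pi
  angle_degenerate : ∀ l : Fin 3 → ℝ, (∀ i, l i ∈ I) → l ∉ D → ∀ i, α l i = 0 ∨ α l i = Real.pi
  sine_law : ∀ l ∈ D, ∃ k, 0 < k ∧ ∀ i, Real.sin (α l i) = k * f (l i)
  variation : ∀ (l : ℝ → Fin 3 → ℝ) (z : Fin 3 → ℝ) (s : ℝ), l s ∈ D →
    (∀ i, HasDerivAt (fun t => l t i) (f (l s i) * z i) s) →
    ∃ α' : Fin 3 → ℝ, (∀ i, HasDerivAt (fun t => α (l t) i) (α' i) s) ∧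
      0 ≤ ∑ i, α' i * z i ∧ (∑ i, α' i * z i = 0 → z ∈ K)
  -- Needed with p = -h - 1 when h ≤ -1, where angles 0 and π have to be avoided.
  path_mem : ∀ p : ℝ, 0 ≤ p → ∀ (l : ℝ → Fin 3 → ℝ) (v : Fin 3 → ℝ),
    (∀ s ∈ Icc (0 : ℝ) 1, ∀ i, l s i ∈ I ∧
      HasDerivAt (fun t => l t i) (v i * f (l s i) ^ (-p)) s) →
    l 0 ∈ D → l 1 ∈ D → ∀ s ∈ Icc (0 : ℝ) 1, l s ∈ D

namespace IsAngleModel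

variable {I : Set ℝ} {f : ℝ → ℝ} {α : (Fin 3 → ℝ) → Fin 3 → ℝ} {D K : Set (Fin 3 → ℝ)}

theorem continuousOn_rpow (M : IsAngleModel I f α D K) (q : ℝ) :
    ContinuousOn (fun t => f t ^ q) I := fun t ht =>
  (M.continuousOn t ht).rpow_const (Or.inl (M.pos t ht).ne')

theorem integral_eq_zero_iff (M : IsAngleModel I f α D K) (q : ℝ) {x y : ℝ} (hx : x ∈ I)
    (hy : y ∈ I) : ∫ t in x..y, f t ^ q = 0 ↔ x = y := by
  have key : ∀ x ∈ I, ∀ y ∈ I, x < y → 0 < ∫ t in x..y, f t ^ q := fun x hx y hy hxy => by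
    have hsub := M.ordConnected.uIcc_subset hx hy
    refine intervalIntegral.intervalIntegral_pos_of_pos_on
      ((M.continuousOn_rpow q).mono hsub).intervalIntegrable (fun t ht => ?_) hxy
    exact Real.rpow_pos_of_pos (M.pos t (hsub (Icc_subset_uIcc (Ioo_subset_Icc_self ht)))) _
  constructor
  · intro h
    rcases lt_trichotomy x y with hxy | hxy | hxy
    · exact absurd h (key x hx y hy hxy).ne'
    · exact hxy
    · rw [intervalIntegral.integral_symm, neg_eq_zero] at h
      exact absurd h (key y hy x hx hxy).ne'
  · rintro rfl; exact intervalIntegral.integral_same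

/-- Along the path on which each ∫ f^(-h-1) grows at constant speed v_i, the derivative of g = Σ
Φ(α_i) v_i is -k^h times the variation form at z_i = v_i f^h. So `g` is antitone. If its end values
agree, it is constant, its derivative at time 0 vanishes, and z at `x` lies in the kernel. -/
theorem sum_sinPowIntegral_sub_mul_nonpos (M : IsAngleModel I f α D K) (h : ℝ)
    {x y : Fin 3 → ℝ} (hx : x ∈ D) (hy : y ∈ D) :
    ∑ i, (sinPowIntegral h (α y i) - sinPowIntegral h (α x i)) *
        ∫ t in x i..y i, f t ^ (-h - 1) ≤ 0 ∧
    (∑ i, (sinPowIntegral h (α y i) - sinPowIntegral h (α x i)) *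
        ∫ t in x i..y i, f t ^ (-h - 1) = 0 →
      (fun i => (∫ t in x i..y i, f t ^ (-h - 1)) * f (x i) ^ h) ∈ K) := by
  have hsub : ∀ i, uIcc (x i) (y i) ⊆ I := fun i =>
    M.ordConnected.uIcc_subset (M.mem x hx i) (M.mem y hy i)
  have hex := fun i => exists_path_of_weight (x := x i) (y := y i)
    ((M.continuousOn_rpow (-h - 1)).mono (hsub i))
    fun t ht => Real.rpow_pos_of_pos (M.pos t (hsub i ht)) _
  choose L hL0 hL1 hL using hex
  set v : Fin 3 → ℝ := fun i => ∫ t in x i..y i, f t ^ (-h - 1) with hv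
  let l : ℝ → Fin 3 → ℝ := fun s i => L i s
  have hl0 : l 0 = x := funext hL0
  have hl1 : l 1 = y := funext hL1
  have hlI : ∀ s ∈ Icc (0 : ℝ) 1, ∀ i, l s i ∈ I := fun s hs i => hsub i (hL i s hs).1
  have hld : ∀ s ∈ Icc (0 : ℝ) 1, ∀ i,
      HasDerivAt (fun t => l t i) (v i * f (l s i) ^ (h + 1)) s := fun s hs i => by
    refine (hL i s hs).2.congr_deriv ?_
    have hp := M.pos _ (hlI s hs i)
    simp only [l] at hp ⊢
    rw [show -h - 1 = -(h + 1) by ring] at hv ⊢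
    rw [Real.rpow_neg hp.le, div_inv_eq_mul, hv]
  have hlc : ∀ s ∈ Icc (0 : ℝ) 1, ContinuousAt l s := fun s hs =>
    continuousAt_pi.2 fun i => (hld s hs i).continuousAt
  let g : ℝ → ℝ := fun s => ∑ i, sinPowIntegral h (α (l s) i) * v i
  have hg : ∀ s ∈ Icc (0 : ℝ) 1, l s ∈ D → ∃ g', (g' ≤ 0 ∧ HasDerivAt g g' s) ∧
      (g' = 0 → (fun i => v i * f (l s i) ^ h) ∈ K) := by
    intro s hs hsD
    obtain ⟨k, hk, hsin⟩ := M.sine_law _ hsD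
    obtain ⟨α', hα', hnn, hK⟩ := M.variation l (fun i => v i * f (l s i) ^ h) s hsD fun i => by
      refine (hld s hs i).congr_deriv ?_
      rw [Real.rpow_add_one (M.pos _ (hlI s hs i)).ne']; ring
    have hkh : 0 < k ^ h := Real.rpow_pos_of_pos hk _
    have hsum : ∑ i, -Real.sin (α (l s) i) ^ h * α' i * v i =
        -(k ^ h * ∑ i, α' i * (v i * f (l s i) ^ h)) := by
      rw [Finset.mul_sum, ← Finset.sum_neg_distrib]
      refine Finset.sum_congr rfl fun i _ => ?_
      rw [hsin, Real.mul_rpow hk.le (M.pos _ (hlI s hs i)).le]; ring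
    have hd : ∀ i, HasDerivAt (fun s => sinPowIntegral h (α (l s) i) * v i)
        (-Real.sin (α (l s) i) ^ h * α' i * v i) s := fun i =>
      (HasDerivAt.comp (h₂ := sinPowIntegral h) s
        (hasDerivAt_sinPowIntegral h (M.angle_mem _ hsD i)) (hα' i)).mul_const (v i)
    refine ⟨_, ⟨?_, HasDerivAt.fun_sum fun i _ => hd i⟩, ?_⟩
    · rw [hsum]; exact neg_nonpos.2 (mul_nonneg hkh.le hnn)
    · rw [hsum, neg_eq_zero, mul_eq_zero]
      rintro (h0 | h0)
      · exact absurd h0 hkh.ne'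
      · exact hK h0
  -- For h > -1 the path may meet degenerate triples; the angles there are 0 or π, which leaves
  -- finitely many values of `g`. For h ≤ -1 the path stays in `D`, so there is nothing to check.
  have hcont : ContinuousOn g (Icc 0 1) ∧ (g '' (Icc 0 1 \ {s | l s ∈ D})).Finite := by
    rcases lt_or_ge (-1) h with hh | hh
    · constructor
      · refine continuousOn_finsetSum _ fun i _ => ContinuousOn.mul ?_ continuousOn_const
        refine (continuousOn_sinPowIntegral hh).comp (fun s hs =>
          ((M.continuousAt_angle _ (hlI s hs) i).comp (hlc s hs)).continuousWithinAt)
          fun s hs => ?_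
        by_cases hsD : l s ∈ D
        · exact Ioo_subset_Icc_self (M.angle_mem _ hsD i)
        · rcases M.angle_degenerate _ (hlI s hs) hsD i with h' | h' <;> rw [h']
          · exact ⟨le_rfl, Real.pi_pos.le⟩
          · exact ⟨Real.pi_pos.le, le_rfl⟩
      · have hfin : (Set.pi univ fun _ : Fin 3 => ({0, Real.pi} : Set ℝ)).Finite :=
          Set.Finite.pi fun _ => by simp
        refine (hfin.image fun a => ∑ i, sinPowIntegral h (a i) * v i).subset ?_
        rintro _ ⟨s, ⟨hs, hsD⟩, rfl⟩
        exact ⟨α (l s), fun i _ => M.angle_degenerate _ (hlI s hs) hsD i, rfl⟩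
    · have hall : ∀ s ∈ Icc (0 : ℝ) 1, l s ∈ D := by
        refine M.path_mem (-h - 1) (by linarith) l v (fun s hs i => ⟨hlI s hs i, ?_⟩)
          (by rwa [hl0]) (by rwa [hl1])
        rw [show -(-h - 1) = h + 1 by ring]; exact hld s hs i
      constructor
      · intro s hs
        obtain ⟨g', hg', _⟩ := hg s hs (hall s hs)
        exact hg'.2.continuousAt.continuousWithinAt
      · rw [show Icc (0 : ℝ) 1 \ {s | l s ∈ D} = ∅ from sdiff_eq_empty.2 hall]
        simp
  have hanti : AntitoneOn g (Icc 0 1) := antitoneOn_of_finite_image_diff hcont.1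
    (fun s hs hsD => (hlc s hs).preimage_mem_nhds (M.isOpen.mem_nhds hsD))
    (fun s hs hsD => (hg s hs hsD).imp fun _ h => h.1) hcont.2
  have h01 : (0 : ℝ) ∈ Icc (0 : ℝ) 1 := ⟨le_rfl, zero_le_one⟩
  have h11 : (1 : ℝ) ∈ Icc (0 : ℝ) 1 := ⟨zero_le_one, le_rfl⟩
  have hdiff : ∑ i, (sinPowIntegral h (α y i) - sinPowIntegral h (α x i)) * v i = g 1 - g 0 := by
    simp only [g, hl0, hl1, sub_mul, Finset.sum_sub_distrib]
  change ∑ i, (sinPowIntegral h (α y i) - sinPowIntegral h (α x i)) * v i ≤ 0 ∧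
    (∑ i, (sinPowIntegral h (α y i) - sinPowIntegral h (α x i)) * v i = 0 →
      (fun i => v i * f (x i) ^ h) ∈ K)
  rw [hdiff]
  refine ⟨sub_nonpos.2 (hanti h01 h11 zero_le_one), fun heq => ?_⟩
  obtain ⟨g', ⟨-, hg'⟩, hK⟩ := hg 0 h01 (by rwa [hl0])
  rw [← hl0]
  refine hK ?_
  have hconst : ∀ s ∈ Icc (0 : ℝ) 1, g s = g 0 := fun s hs =>
    le_antisymm (hanti h01 hs hs.1) (by linarith [hanti hs h11 hs.2])
  have e1 := hg'.hasDerivWithinAt (s := Icc 0 1)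
  have e2 : HasDerivWithinAt g 0 (Icc 0 1) 0 :=
    (hasDerivWithinAt_const (0 : ℝ) (Icc 0 1) (g 0)).congr hconst rfl
  exact (uniqueDiffOn_Icc zero_lt_one 0 h01).eq_deriv _ e1 e2

end IsAngleModel

/-! ### Summation over the triangulation -/

namespace BorderedTriangulatedSurface

variable {F E : Type*} [Fintype F] [DecidableEq E]

/-- The length integral depends only on the edge. Regrouped by edges, the sum of the one-triangle
inequalities is therefore a sum of products of a curvature difference and a length integral, and one
factor vanishes on each edge. Nonpositive terms with sum 0 are all 0. -/
theorem mem_kernel_of_curvature_eq (S : BorderedTriangulatedSurface F E) {I : Set ℝ} {f : ℝ → ℝ}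
    {α : (Fin 3 → ℝ) → Fin 3 → ℝ} {D K : Set (Fin 3 → ℝ)} (M : IsAngleModel I f α D K) (h : ℝ)
    {d₁ d₂ : E → ℝ} (h₁ : ∀ t, S.sideLengths d₁ t ∈ D) (h₂ : ∀ t, S.sideLengths d₂ t ∈ D)
    (hb : ∀ e, S.IsBoundaryEdge e → d₁ e = d₂ e)
    (hc : ∀ e, S.IsInteriorEdge e →
      ∑ s ∈ S.sides e, sinPowIntegral h (α (S.sideLengths d₁ s.1) s.2) =
        ∑ s ∈ S.sides e, sinPowIntegral h (α (S.sideLengths d₂ s.1) s.2)) (t : F) :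
    (fun i => (∫ r in S.sideLengths d₁ t i..S.sideLengths d₂ t i, f r ^ (-h - 1)) *
      f (S.sideLengths d₁ t i) ^ h) ∈ K := by
  have key := fun t => M.sum_sinPowIntegral_sub_mul_nonpos h (h₁ t) (h₂ t)
  have hsum : ∑ t, ∑ i, (sinPowIntegral h (α (S.sideLengths d₂ t) i) -
      sinPowIntegral h (α (S.sideLengths d₁ t) i)) *
      ∫ r in S.sideLengths d₁ t i..S.sideLengths d₂ t i, f r ^ (-h - 1) = 0 := by
    -- There is no `Fintype` instance on `E`; the image of `S.edge` is the finite index set of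
    -- edges.
    rw [← Fintype.sum_prod_type' (f := fun t i => (sinPowIntegral h (α (S.sideLengths d₂ t) i) -
      sinPowIntegral h (α (S.sideLengths d₁ t) i)) *
      ∫ r in S.sideLengths d₁ t i..S.sideLengths d₂ t i, f r ^ (-h - 1)),
      ← Finset.sum_fiberwise_of_maps_to (t := Finset.univ.image S.edge) (g := S.edge)
        fun s hs => Finset.mem_image_of_mem _ hs]
    refine Finset.sum_eq_zero fun e _ => ?_
    have hrw : ∀ s ∈ S.sides e, (sinPowIntegral h (α (S.sideLengths d₂ s.1) s.2) -
        sinPowIntegral h (α (S.sideLengths d₁ s.1) s.2)) *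
        (∫ r in S.sideLengths d₁ s.1 s.2..S.sideLengths d₂ s.1 s.2, f r ^ (-h - 1)) =
        (sinPowIntegral h (α (S.sideLengths d₂ s.1) s.2) -
        sinPowIntegral h (α (S.sideLengths d₁ s.1) s.2)) *
        ∫ r in d₁ e..d₂ e, f r ^ (-h - 1) := fun s hs => by
      have he : S.edge s = e := (Finset.mem_filter.1 hs).2
      simp only [sideLengths, Prod.mk.eta, he]
    refine (Finset.sum_congr rfl hrw).trans ?_
    rw [← Finset.sum_mul, Finset.sum_sub_distrib]
    by_cases hbe : S.IsBoundaryEdge e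
    · rw [hb e hbe, intervalIntegral.integral_same, mul_zero]
    · rw [hc e hbe, sub_self, zero_mul]
  have hz := (Finset.sum_eq_zero_iff_of_nonpos fun t _ => (key t).1).1 hsum t (Finset.mem_univ t)
  exact (key t).2 hz

theorem eq_of_curvature_eq (S : BorderedTriangulatedSurface F E) {I : Set ℝ} {f : ℝ → ℝ}
    {α : (Fin 3 → ℝ) → Fin 3 → ℝ} {D : Set (Fin 3 → ℝ)} (M : IsAngleModel I f α D {0}) (h : ℝ)
    {d₁ d₂ : E → ℝ} (h₁ : ∀ t, S.sideLengths d₁ t ∈ D) (h₂ : ∀ t, S.sideLengths d₂ t ∈ D)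
    (hb : ∀ e, S.IsBoundaryEdge e → d₁ e = d₂ e)
    (hc : ∀ e, S.IsInteriorEdge e →
      ∑ s ∈ S.sides e, sinPowIntegral h (α (S.sideLengths d₁ s.1) s.2) =
        ∑ s ∈ S.sides e, sinPowIntegral h (α (S.sideLengths d₂ s.1) s.2)) : d₁ = d₂ := by
  funext e
  obtain ⟨⟨t, i⟩, rfl⟩ := S.edge_surjective e
  have hz := congrFun (mem_singleton_iff.1 (S.mem_kernel_of_curvature_eq M h h₁ h₂ hb hc t)) i
  have hx := M.mem _ (h₁ t) i
  have hy := M.mem _ (h₂ t) i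
  rcases mul_eq_zero.1 hz with h0 | h0
  · exact (M.integral_eq_zero_iff _ hx hy).1 h0
  · exact absurd h0 (Real.rpow_pos_of_pos (M.pos _ hx) _).ne'

/-- Two length functions that are proportional on each triangle are equal if they agree on the
boundary. -/
theorem eq_of_proportional (S : BorderedTriangulatedSurface F E) {d₁ d₂ : E → ℝ}
    (h₁ : ∀ e, 0 < d₁ e) (hp : ∀ t, ∃ c, ∀ i, S.sideLengths d₂ t i = c * S.sideLengths d₁ t i)
    (hb : ∀ e, S.IsBoundaryEdge e → d₁ e = d₂ e) : d₁ = d₂ := by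
  choose c hc using hp
  obtain ⟨e₀, he₀⟩ := S.exists_boundary
  obtain ⟨⟨t₀, i₀⟩, rfl⟩ := S.edge_surjective e₀
  have h0 : c t₀ = 1 := by
    have h1 := hc t₀ i₀
    simp only [sideLengths] at h1
    rw [← hb _ he₀] at h1
    exact mul_right_cancel₀ (h₁ _).ne' (by rw [one_mul]; exact h1.symm)
  have hall : ∀ t, c t = 1 := fun t => by
    induction S.connected t₀ t with
    | refl => exact h0
    | @tail t₁ t₂ _ hstep ih =>
      obtain ⟨i, j, hij⟩ := hstep
      have e1 := hc t₁ i
      have e2 := hc t₂ j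
      simp only [sideLengths] at e1 e2
      rw [hij, ih] at e1
      exact mul_right_cancel₀ (h₁ _).ne' (e2.symm.trans e1)
  funext e
  obtain ⟨⟨t, i⟩, rfl⟩ := S.edge_surjective e
  have := hc t i
  rw [hall, one_mul] at this
  exact this.symm

end BorderedTriangulatedSurface

/-! ### Quadratic forms, arccosines and the triangle inequality -/

/-- Positivity of a ternary quadratic form with positive leading principal minors. -/
theorem ternary_form_pos {a b c d e f : ℝ} (h₁ : 0 < a) (h₂ : 0 < a * b - d ^ 2)
    (h₃ : 0 < a * b * c + 2 * d * e * f - a * f ^ 2 - b * e ^ 2 - c * d ^ 2) (x y z : ℝ) :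
    0 ≤ a * x ^ 2 + b * y ^ 2 + c * z ^ 2 + 2 * d * x * y + 2 * e * x * z + 2 * f * y * z ∧
    (a * x ^ 2 + b * y ^ 2 + c * z ^ 2 + 2 * d * x * y + 2 * e * x * z + 2 * f * y * z = 0 →
      x = 0 ∧ y = 0 ∧ z = 0) := by
  set q := a * x ^ 2 + b * y ^ 2 + c * z ^ 2 + 2 * d * x * y + 2 * e * x * z + 2 * f * y * z with hq
  set m := a * b - d ^ 2
  set Δ := a * b * c + 2 * d * e * f - a * f ^ 2 - b * e ^ 2 - c * d ^ 2
  -- Completion of squares, cleared of denominators.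
  have hid : a * m * q = m * (a * x + d * y + e * z) ^ 2 + (m * y + (a * f - d * e) * z) ^ 2 +
      a * Δ * z ^ 2 := by
    simp only [q, m, Δ]; ring
  have t1 : 0 ≤ m * (a * x + d * y + e * z) ^ 2 := by positivity
  have t2 : 0 ≤ (m * y + (a * f - d * e) * z) ^ 2 := by positivity
  have t3 : 0 ≤ a * Δ * z ^ 2 := by positivity
  constructor
  · exact nonneg_of_mul_nonneg_right (by rw [hid]; positivity) (mul_pos h₁ h₂)
  · intro h0
    rw [h0, mul_zero] at hid
    have hz : z = 0 := by
      have : a * Δ * z ^ 2 = 0 := by linarith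
      simpa [h₁.ne', h₃.ne'] using this
    subst hz
    have hy : y = 0 := by
      have : (m * y + (a * f - d * e) * 0) ^ 2 = 0 := by linarith
      simpa [h₂.ne'] using this
    subst hy
    have : m * (a * x + d * 0 + e * 0) ^ 2 = 0 := by linarith
    exact ⟨by simpa [h₁.ne', h₂.ne'] using this, rfl, rfl⟩

/-- Derivative of `arccos` along a path, with the sine of the angle as denominator. -/
theorem HasDerivAt.arccos_of_mem {c : ℝ → ℝ} {c' s : ℝ} (hc : HasDerivAt c c' s)
    (h₁ : -1 < c s) (h₂ : c s < 1) :
    HasDerivAt (fun t => Real.arccos (c t)) (-c' / Real.sin (Real.arccos (c s))) s := by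
  refine ((Real.hasDerivAt_arccos h₁.ne' h₂.ne).comp s hc).congr_deriv ?_
  rw [Real.sin_arccos]; ring

theorem arccos_mem_Ioo {x : ℝ} (h₁ : -1 < x) (h₂ : x < 1) : Real.arccos x ∈ Ioo 0 Real.pi :=
  ⟨Real.arccos_pos.2 h₂, lt_of_le_of_ne (Real.arccos_le_pi x) fun h => by
    have := Real.arccos_eq_pi.1 h; linarith⟩

/-- A vanishing cosine sum leaves a + b + c = π or b + c - a = π. If the second alternative held in
both hypotheses, adding would give c = π. -/
theorem angle_sum_eq_pi {a b c : ℝ} (ha : a ∈ Ioo 0 Real.pi) (hb : b ∈ Ioo 0 Real.pi)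
    (hc : c ∈ Ioo 0 Real.pi) (h₁ : Real.cos (b + c) + Real.cos a = 0)
    (h₂ : Real.cos (c + a) + Real.cos b = 0) :
    a + b + c = Real.pi := by
  have key : ∀ {x y z : ℝ}, x ∈ Ioo 0 Real.pi → y ∈ Ioo 0 Real.pi → z ∈ Ioo 0 Real.pi →
      Real.cos (y + z) + Real.cos x = 0 → x + y + z = Real.pi ∨ y + z - x = Real.pi := by
    intro x y z hx hy hz h
    rcases le_total (y + z) Real.pi with hle | hle
    · left
      have := Real.injOn_cos (x₁ := y + z) (x₂ := Real.pi - x)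
        ⟨by linarith [hy.1, hz.1], hle⟩ ⟨by linarith [hx.2], by linarith [hx.1]⟩
        (by rw [Real.cos_pi_sub]; linarith)
      linarith
    · right
      have := Real.injOn_cos (x₁ := 2 * Real.pi - (y + z)) (x₂ := Real.pi - x)
        ⟨by linarith [hy.2, hz.2], by linarith⟩ ⟨by linarith [hx.2], by linarith [hx.1]⟩
        (by rw [Real.cos_pi_sub, Real.cos_two_pi_sub]; linarith)
      linarith
  rcases key ha hb hc h₁ with h | h
  · exact h
  rcases key hb hc ha h₂ with h' | h'
  · linarith
  · linarith [hc.2]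

theorem angle_sum_lt_pi {a b c : ℝ} (ha : a ∈ Ioo 0 Real.pi) (hb : b ∈ Ioo 0 Real.pi)
    (hc : c ∈ Ioo 0 Real.pi) (h₁ : 0 < Real.cos (b + c) + Real.cos a)
    (h₂ : 0 < Real.cos (c + a) + Real.cos b) :
    a + b + c < Real.pi := by
  have key : ∀ {x y z : ℝ}, x ∈ Ioo 0 Real.pi → y ∈ Ioo 0 Real.pi → z ∈ Ioo 0 Real.pi →
      0 < Real.cos (y + z) + Real.cos x → x + y + z < Real.pi ∨ Real.pi < y + z - x := by
    intro x y z hx hy hz h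
    rcases le_total (y + z) Real.pi with hle | hle
    · left
      have := (Real.strictAntiOn_cos.lt_iff_gt (a := Real.pi - x) (b := y + z)
        ⟨by linarith [hx.2], by linarith [hx.1]⟩ ⟨by linarith [hy.1, hz.1], hle⟩).1
        (by rw [Real.cos_pi_sub]; linarith)
      linarith
    · right
      have := (Real.strictAntiOn_cos.lt_iff_gt (a := Real.pi - x) (b := 2 * Real.pi - (y + z))
        ⟨by linarith [hx.2], by linarith [hx.1]⟩ ⟨by linarith [hy.2, hz.2], by linarith⟩).1
        (by rw [Real.cos_pi_sub, Real.cos_two_pi_sub]; linarith)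
      linarith
  rcases key ha hb hc h₁ with h | h
  · exact h
  rcases key hb hc ha h₂ with h' | h'
  · linarith
  · linarith [hc.2]

/-- In each geometry a single `P` serves all three angles of a triangle, and this is the source of
the common factor in the sine law and of the common denominator in the derivatives. -/
theorem arccos_div_of_sq {N m P : ℝ} (hm : 0 < m) (hP : 0 < P) (hPsq : P ^ 2 = m ^ 2 - N ^ 2) :
    -1 < N / m ∧ N / m < 1 ∧ Real.sin (Real.arccos (N / m)) = P / m := by
  have h1 : 1 - (N / m) ^ 2 = (P / m) ^ 2 := by
    rw [div_pow, div_pow, hPsq]; field_simp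
  have h2 : (N / m) ^ 2 < 1 := by
    have : 0 < (P / m) ^ 2 := by positivity
    linarith
  obtain ⟨h3, h4⟩ := abs_lt.1 ((sq_lt_one_iff_abs_lt_one _).1 h2)
  refine ⟨h3, h4, ?_⟩
  rw [Real.sin_arccos, h1, Real.sqrt_sq (by positivity)]

theorem hasDerivAt_arccos_div {N m : ℝ → ℝ} {N' m' s P : ℝ} (hN : HasDerivAt N N' s)
    (hm : HasDerivAt m m' s) (hm0 : 0 < m s) (hP : 0 < P) (hPsq : P ^ 2 = m s ^ 2 - N s ^ 2) :
    HasDerivAt (fun t => Real.arccos (N t / m t)) ((N s * m' - N' * m s) / (m s * P)) s := by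
  obtain ⟨h1, h2, h3⟩ := arccos_div_of_sq hm0 hP hPsq
  refine ((hN.div hm hm0.ne').arccos_of_mem h1 h2).congr_deriv ?_
  simp only [Pi.div_apply]
  rw [h3]
  field_simp
  ring

/-- `Real.arccos` is constant on each side of [-1, 1]; this is what extends the angles continuously
to degenerate triples. -/
theorem arccos_div_eq_pi {N m : ℝ} (hm : 0 < m) (h : m + N ≤ 0) : Real.arccos (N / m) = Real.pi :=
  Real.arccos_eq_pi.2 (by rw [div_le_iff₀ hm]; linarith)

theorem arccos_div_eq_zero {N m : ℝ} (hm : 0 < m) (h : m - N ≤ 0) : Real.arccos (N / m) = 0 :=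
  Real.arccos_eq_zero.2 (by rw [le_div_iff₀ hm]; linarith)

/-- A statement about all three cyclic relabelings. -/
theorem forall_fin_three_cyclic {P : ℝ → ℝ → ℝ → Prop} {l : Fin 3 → ℝ} :
    (∀ i, P (l i) (l (i + 1)) (l (i + 2))) ↔
      P (l 0) (l 1) (l 2) ∧ P (l 1) (l 2) (l 0) ∧ P (l 2) (l 0) (l 1) :=
  ⟨fun h => ⟨h 0, h 1, h 2⟩, fun h i => by
    fin_cases i
    exacts [h.1, h.2.1, h.2.2]⟩

theorem isOpen_strict_triangle :
    IsOpen {l : Fin 3 → ℝ | (∀ i, 0 < l i) ∧ ∀ i, l i < l (i + 1) + l (i + 2)} := by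
  simp only [ofPred_and, ofPred_forall]
  refine (isOpen_iInter_of_finite fun i => ?_).inter (isOpen_iInter_of_finite fun i => ?_)
  · exact isOpen_lt continuous_const (continuous_apply i)
  · exact isOpen_lt (continuous_apply i) (by fun_prop)

/-- The path condition of an angle model for the strict triangle inequalities. -/
theorem strict_triangle_of_path {I : Set ℝ} {f f' : ℝ → ℝ} (hI : I.OrdConnected) (hIo : IsOpen I)
    (hI0 : I ⊆ Ioi 0) (hf : ∀ t ∈ I, HasDerivAt f (f' t) t) (hpos : ∀ t ∈ I, 0 < f t)
    (hκ : ∀ a ∈ I, ∀ b ∈ I, a + b ∈ I → ∀ x y : ℝ,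
      f' (a + b) / f (a + b) * (x + y) ^ 2 ≤ f' a / f a * x ^ 2 + f' b / f b * y ^ 2)
    {p : ℝ} (hp : 0 ≤ p) {l : ℝ → Fin 3 → ℝ} {v : Fin 3 → ℝ}
    (hl : ∀ s ∈ Icc (0 : ℝ) 1, ∀ i, l s i ∈ I ∧
      HasDerivAt (fun t => l t i) (v i * f (l s i) ^ (-p)) s)
    (h0 : ∀ i, l 0 i < l 0 (i + 1) + l 0 (i + 2)) (h1 : ∀ i, l 1 i < l 1 (i + 1) + l 1 (i + 2)) :
    ∀ s ∈ Icc (0 : ℝ) 1, ∀ i, l s i < l s (i + 1) + l s (i + 2) := fun s hs i =>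
  lt_add_of_path hI hIo hI0 hf hpos hκ hp (fun s hs => hl s hs (i + 1)) (fun s hs => hl s hs (i + 2))
    (fun s hs => hl s hs i) (h0 i) (h1 i) s hs

/-! ### Euclidean triangles -/

namespace PlaneGeometry

theorem euclidean_heron_pos {a b c : ℝ} (ha : 0 < a) (hb : 0 < b) (hc : 0 < c) (h1 : a < b + c)
    (h2 : b < c + a) (h3 : c < a + b) :
    0 < 2 * a ^ 2 * b ^ 2 + 2 * b ^ 2 * c ^ 2 + 2 * c ^ 2 * a ^ 2 - a ^ 4 - b ^ 4 - c ^ 4 := by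
  have : 0 < (a + b + c) * (b + c - a) * (c + a - b) * (a + b - c) :=
    mul_pos (mul_pos (mul_pos (by linarith) (by linarith)) (by linarith)) (by linarith)
  nlinarith [this]

/-- Nondegenerate Euclidean triangles have a positive `P` (four times the area) from which all
sines and derivatives of the angles are computed. -/
theorem euclidean_exists_area {l : Fin 3 → ℝ} (hl : euclidean.IsTriangle l) :
    ∃ P, 0 < P ∧ ∀ i, P ^ 2 = (2 * l (i + 1) * l (i + 2)) ^ 2 -
      (l (i + 1) ^ 2 + l (i + 2) ^ 2 - l i ^ 2) ^ 2 := by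
  obtain ⟨hpos, htri, -⟩ := hl
  have h := euclidean_heron_pos (hpos 0) (hpos 1) (hpos 2) (htri 0) (htri 1) (htri 2)
  refine ⟨_, Real.sqrt_pos.2 h, ?_⟩
  rw [Real.sq_sqrt h.le]
  refine forall_fin_three_cyclic (P := fun a b c => _ = (2 * b * c) ^ 2 -
    (b ^ 2 + c ^ 2 - a ^ 2) ^ 2).2 ⟨by ring, by ring, by ring⟩

theorem hasDerivAt_euclidean_angle {a b c : ℝ → ℝ} {x y z s P : ℝ}
    (ha : HasDerivAt a (a s * x) s) (hb : HasDerivAt b (b s * y) s) (hc : HasDerivAt c (c s * z) s)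
    (hb0 : 0 < b s) (hc0 : 0 < c s) (hP : 0 < P)
    (hPsq : P ^ 2 = (2 * b s * c s) ^ 2 - (b s ^ 2 + c s ^ 2 - a s ^ 2) ^ 2) :
    HasDerivAt (fun t => Real.arccos ((b t ^ 2 + c t ^ 2 - a t ^ 2) / (2 * b t * c t)))
      ((2 * a s ^ 2 * x - 2 * b s ^ 2 * y - 2 * c s ^ 2 * z +
        (b s ^ 2 + c s ^ 2 - a s ^ 2) * (y + z)) / P) s := by
  have hN := ((hb.fun_pow 2).fun_add (hc.fun_pow 2)).fun_sub (ha.fun_pow 2)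
  have hm := (hb.const_mul 2).fun_mul hc
  refine (hasDerivAt_arccos_div hN hm (by positivity) hP hPsq).congr_deriv ?_
  field_simp
  ring

theorem continuousAt_euclidean_angle {l : Fin 3 → ℝ} (hl : ∀ i, 0 < l i) (i : Fin 3) :
    ContinuousAt (fun l => euclidean.angle l i) l := by
  refine Real.continuous_arccos.continuousAt.comp (ContinuousAt.div ?_ ?_ ?_)
  · fun_prop
  · fun_prop
  · have := hl (i + 1); have := hl (i + 2); positivity

theorem isAngleModel_euclidean :
    IsAngleModel (Ioi 0) (fun t => t) euclidean.angle {l | euclidean.IsTriangle l}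
      {z | ∀ i j, z i = z j} where
  ordConnected := ordConnected_Ioi
  continuousOn := continuousOn_id
  pos _ ht := ht
  mem l hl i := hl.1 i
  isOpen := by
    simpa only [IsTriangle, and_true] using isOpen_strict_triangle
  continuousAt_angle _ hl i := continuousAt_euclidean_angle hl i
  angle_mem l hl i := by
    obtain ⟨P, hP, hPsq⟩ := euclidean_exists_area hl
    have h1 := hl.1 (i + 1)
    have h2 := hl.1 (i + 2)
    obtain ⟨h3, h4, -⟩ := arccos_div_of_sq (by positivity) hP (hPsq i)
    exact arccos_mem_Ioo h3 h4
  angle_degenerate l hl hlD := by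
    have hl' : ∀ i, 0 < l i := hl
    have hex : ∃ i, l (i + 1) + l (i + 2) ≤ l i := by
      by_contra! hall
      exact hlD ⟨hl', hall, trivial⟩
    have key : ∀ a b c : ℝ, 0 < a → 0 < b → 0 < c → b + c ≤ a →
        Real.arccos ((b ^ 2 + c ^ 2 - a ^ 2) / (2 * b * c)) = Real.pi ∧
        Real.arccos ((c ^ 2 + a ^ 2 - b ^ 2) / (2 * c * a)) = 0 ∧
        Real.arccos ((a ^ 2 + b ^ 2 - c ^ 2) / (2 * a * b)) = 0 := fun a b c ha hb hc h =>
      ⟨arccos_div_eq_pi (by positivity) (by nlinarith),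
        arccos_div_eq_zero (by positivity) (by nlinarith),
        arccos_div_eq_zero (by positivity) (by nlinarith)⟩
    obtain ⟨j, hj⟩ := hex
    obtain ⟨k1, k2, k3⟩ := key _ _ _ (hl' j) (hl' (j + 1)) (hl' (j + 2)) hj
    intro i
    fin_cases j <;> fin_cases i <;> first
      | exact Or.inr k1
      | exact Or.inl k2
      | exact Or.inl k3
  sine_law l hl := by
    obtain ⟨P, hP, hPsq⟩ := euclidean_exists_area hl
    have h0 := hl.1 0
    have h1 := hl.1 1
    have h2 := hl.1 2
    refine ⟨P / (2 * l 0 * l 1 * l 2), by positivity, fun i => ?_⟩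
    have h3 := hl.1 (i + 1)
    have h4 := hl.1 (i + 2)
    refine (arccos_div_of_sq (by positivity) hP (hPsq i)).2.2.trans ?_
    refine forall_fin_three_cyclic (P := fun a b c =>
      P / (2 * b * c) = P / (2 * l 0 * l 1 * l 2) * a).2 ⟨?_, ?_, ?_⟩ i <;> field_simp
  variation l z s hs hd := by
    obtain ⟨P, hP, hPsq⟩ := euclidean_exists_area hs
    refine ⟨_, fun i => hasDerivAt_euclidean_angle (hd i) (hd (i + 1)) (hd (i + 2)) (hs.1 _)
      (hs.1 _) hP (hPsq i), ?_⟩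
    have h0 := hs.1 0
    have h1 := hs.1 1
    have hPsq0 := hPsq 0
    simp only [Fin.sum_univ_three, Fin.isValue, Fin.reduceAdd, zero_add] at hPsq0 ⊢
    set a := l s 0
    set b := l s 1
    set c := l s 2
    set x := z 0
    set y := z 1
    set w := z 2
    set q := (2 * a ^ 2 * x - 2 * b ^ 2 * y - 2 * c ^ 2 * w + (b ^ 2 + c ^ 2 - a ^ 2) * (y + w)) / P * x +
      (2 * b ^ 2 * y - 2 * c ^ 2 * w - 2 * a ^ 2 * x + (c ^ 2 + a ^ 2 - b ^ 2) * (w + x)) / P * y +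
      (2 * c ^ 2 * w - 2 * a ^ 2 * x - 2 * b ^ 2 * y + (a ^ 2 + b ^ 2 - c ^ 2) * (x + y)) / P * w with hq
    -- Both squares vanish only for x = y = w, the infinitesimal scalings.
    have hid : 2 * a ^ 2 * P * q = (2 * a ^ 2 * (x - w) - (a ^ 2 + b ^ 2 - c ^ 2) * (y - w)) ^ 2 +
        P ^ 2 * (y - w) ^ 2 := by
      rw [hPsq0, hq]; field_simp; ring
    have haP : 0 < 2 * a ^ 2 * P := by positivity
    refine ⟨nonneg_of_mul_nonneg_right (by rw [hid]; positivity) haP, fun h => ?_⟩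
    rw [h, mul_zero] at hid
    have hn1 : 0 ≤ (2 * a ^ 2 * (x - w) - (a ^ 2 + b ^ 2 - c ^ 2) * (y - w)) ^ 2 := by positivity
    have hn2 : 0 ≤ P ^ 2 * (y - w) ^ 2 := by positivity
    have t1 : P ^ 2 * (y - w) ^ 2 = 0 := by linarith
    have hyw : y = w := by
      have : y - w = 0 := by simpa [hP.ne'] using t1
      linarith
    have hxw : x = w := by
      rw [t1, hyw] at hid
      have : x - w = 0 := by simpa [h0.ne'] using hid.symm
      linarith
    intro i j
    fin_cases i <;> fin_cases j <;> simp [x, y, w] at hyw hxw ⊢ <;> linarith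
  path_mem p hp l v hl h0 h1 s hs := by
    refine ⟨fun i => (hl s hs i).1, strict_triangle_of_path ordConnected_Ioi isOpen_Ioi
      subset_rfl (f' := fun _ => 1) (fun t _ => hasDerivAt_id' t) (fun t ht => ht) ?_ hp hl
      h0.2.1 h1.2.1 s hs, trivial⟩
    intro a ha b hb _ x y
    have ha' : 0 < a := ha
    have hb' : 0 < b := hb
    have hid : 1 / a * x ^ 2 + 1 / b * y ^ 2 - 1 / (a + b) * (x + y) ^ 2 =
        (b * x - a * y) ^ 2 / (a * b * (a + b)) := by
      field_simp; ring
    have : 0 ≤ (b * x - a * y) ^ 2 / (a * b * (a + b)) := by positivity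
    linarith

end PlaneGeometry

/-! ### Spherical triangles -/

namespace PlaneGeometry

theorem cos_add_lt_cos {a b c : ℝ} (ha : a ∈ Ioo 0 Real.pi) (h1 : a < b + c) (h2 : a + b + c < 2 * Real.pi) :
    Real.cos (b + c) < Real.cos a := by
  rcases le_total (b + c) Real.pi with h | h
  · exact Real.cos_lt_cos_of_nonneg_of_le_pi ha.1.le h h1
  · rw [← Real.cos_two_pi_sub (b + c)]
    exact Real.cos_lt_cos_of_nonneg_of_le_pi ha.1.le (by linarith) (by linarith)

/-- The Gram determinant factors as (cos a - cos(b+c)) (cos(b-c) - cos a). The first factor is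
positive by a < b + c and the perimeter bound, the second by the other two triangle inequalities. -/
theorem spherical_gram_pos {a b c : ℝ} (ha : a ∈ Ioo 0 Real.pi) (h1 : a < b + c) (h2 : b < c + a) (h3 : c < a + b)
    (h4 : a + b + c < 2 * Real.pi) :
    0 < 1 - Real.cos a ^ 2 - Real.cos b ^ 2 - Real.cos c ^ 2 +
      2 * Real.cos a * Real.cos b * Real.cos c := by
  have k1 := cos_add_lt_cos ha h1 h4
  have k2 : Real.cos a < Real.cos (b - c) := by
    rw [← Real.cos_abs (b - c)]
    exact Real.cos_lt_cos_of_nonneg_of_le_pi (abs_nonneg _) ha.2.le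
      (abs_lt.2 ⟨by linarith, by linarith⟩)
  have k3 := mul_pos (sub_pos.2 k1) (sub_pos.2 k2)
  rw [Real.cos_add, Real.cos_sub] at k3
  have eb := Real.sin_sq b
  have ec := Real.sin_sq c
  have : (Real.cos a - (Real.cos b * Real.cos c - Real.sin b * Real.sin c)) *
      (Real.cos b * Real.cos c + Real.sin b * Real.sin c - Real.cos a) =
      1 - Real.cos a ^ 2 - Real.cos b ^ 2 - Real.cos c ^ 2 +
      2 * Real.cos a * Real.cos b * Real.cos c := by
    linear_combination (1 - Real.cos c ^ 2) * eb + Real.sin b ^ 2 * ec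
  rwa [this] at k3

theorem IsTriangle.mem_Ioo {l : Fin 3 → ℝ} (hl : spherical.IsTriangle l) (i : Fin 3) :
    l i ∈ Ioo 0 Real.pi :=
  ⟨hl.1 i, hl.2.2.1 i⟩

theorem spherical_exists_gram {l : Fin 3 → ℝ} (hl : spherical.IsTriangle l) :
    ∃ P, 0 < P ∧ P ^ 2 = 1 - Real.cos (l 0) ^ 2 - Real.cos (l 1) ^ 2 - Real.cos (l 2) ^ 2 +
      2 * Real.cos (l 0) * Real.cos (l 1) * Real.cos (l 2) ∧
      ∀ i, P ^ 2 = (Real.sin (l (i + 1)) * Real.sin (l (i + 2))) ^ 2 -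
      (Real.cos (l i) - Real.cos (l (i + 1)) * Real.cos (l (i + 2))) ^ 2 := by
  have h := spherical_gram_pos (b := l 1) (c := l 2) (hl.mem_Ioo 0) (hl.2.1 0) (hl.2.1 1)
    (hl.2.1 2) hl.2.2.2
  refine ⟨_, Real.sqrt_pos.2 h, Real.sq_sqrt h.le, ?_⟩
  rw [Real.sq_sqrt h.le]
  refine forall_fin_three_cyclic (P := fun a b c => _ = (Real.sin b * Real.sin c) ^ 2 -
    (Real.cos a - Real.cos b * Real.cos c) ^ 2).2 ⟨?_, ?_, ?_⟩ <;>
  · simp only [mul_pow, Real.sin_sq]; ring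

theorem hasDerivAt_spherical_angle {a b c : ℝ → ℝ} {x y z s P : ℝ}
    (ha : HasDerivAt a (Real.sin (a s) * x) s) (hb : HasDerivAt b (Real.sin (b s) * y) s)
    (hc : HasDerivAt c (Real.sin (c s) * z) s)
    (hb0 : 0 < Real.sin (b s)) (hc0 : 0 < Real.sin (c s)) (hP : 0 < P)
    (hPsq : P ^ 2 = (Real.sin (b s) * Real.sin (c s)) ^ 2 -
      (Real.cos (a s) - Real.cos (b s) * Real.cos (c s)) ^ 2) :
    HasDerivAt (fun t => Real.arccos ((Real.cos (a t) - Real.cos (b t) * Real.cos (c t)) /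
        (Real.sin (b t) * Real.sin (c t))))
      ((Real.sin (a s) ^ 2 * x + (Real.cos (a s) * Real.cos (b s) - Real.cos (c s)) * y +
        (Real.cos (a s) * Real.cos (c s) - Real.cos (b s)) * z) / P) s := by
  have hN := ha.cos.fun_sub (hb.cos.fun_mul hc.cos)
  have hm := hb.sin.fun_mul hc.sin
  refine (hasDerivAt_arccos_div hN hm (by positivity) hP hPsq).congr_deriv ?_
  have eb := Real.sin_sq (b s)
  have ec := Real.sin_sq (c s)
  rw [div_eq_div_iff (by positivity) hP.ne']
  linear_combination (-(Real.sin (b s) * Real.sin (c s) * P) * Real.cos (c s) * y) * eb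
    - (Real.sin (b s) * Real.sin (c s) * P) * Real.cos (b s) * z * ec

theorem continuousAt_spherical_angle {l : Fin 3 → ℝ} (hl : ∀ i, l i ∈ Ioo 0 Real.pi) (i : Fin 3) :
    ContinuousAt (fun l => spherical.angle l i) l := by
  refine Real.continuous_arccos.continuousAt.comp (ContinuousAt.div ?_ ?_ ?_)
  · fun_prop
  · fun_prop
  · have h1 := Real.sin_pos_of_mem_Ioo (hl (i + 1))
    have h2 := Real.sin_pos_of_mem_Ioo (hl (i + 2))
    positivity

theorem spherical_angle_degenerate {l : Fin 3 → ℝ} (hl : ∀ i, l i ∈ Ioo 0 Real.pi)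
    (hlD : ¬ spherical.IsTriangle l) (i : Fin 3) :
    spherical.angle l i = 0 ∨ spherical.angle l i = Real.pi := by
  have hs : ∀ i, 0 < Real.sin (l i) := fun i => Real.sin_pos_of_mem_Ioo (hl i)
  have hpi : ∀ a b c : ℝ, 0 < Real.sin b → 0 < Real.sin c → Real.cos a ≤ Real.cos (b + c) →
      Real.arccos ((Real.cos a - Real.cos b * Real.cos c) / (Real.sin b * Real.sin c)) =
        Real.pi := fun a b c hb hc h =>
    arccos_div_eq_pi (mul_pos hb hc) (by rw [Real.cos_add] at h; linarith)
  have hzero : ∀ a b c : ℝ, 0 < Real.sin b → 0 < Real.sin c → Real.cos (b - c) ≤ Real.cos a →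
      Real.arccos ((Real.cos a - Real.cos b * Real.cos c) / (Real.sin b * Real.sin c)) =
        0 := fun a b c hb hc h =>
    arccos_div_eq_zero (mul_pos hb hc) (by rw [Real.cos_sub] at h; linarith)
  by_cases hsum : l 0 + l 1 + l 2 < 2 * Real.pi
  · have hex : ∃ j, l (j + 1) + l (j + 2) ≤ l j := by
      by_contra! hall
      exact hlD ⟨fun i => (hl i).1, hall, fun i => (hl i).2, hsum⟩
    have key : ∀ a b c : ℝ, a ∈ Ioo 0 Real.pi → b ∈ Ioo 0 Real.pi → c ∈ Ioo 0 Real.pi →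
        b + c ≤ a → Real.cos a ≤ Real.cos (b + c) ∧ Real.cos (c - a) ≤ Real.cos b ∧
          Real.cos (a - b) ≤ Real.cos c := fun a b c ha hb hc h => by
      refine ⟨Real.cos_le_cos_of_nonneg_of_le_pi (by linarith [hb.1, hc.1]) ha.2.le h, ?_,
        Real.cos_le_cos_of_nonneg_of_le_pi hc.1.le (by linarith [ha.2, hb.1]) (by linarith)⟩
      rw [← Real.cos_neg (c - a), neg_sub]
      exact Real.cos_le_cos_of_nonneg_of_le_pi hb.1.le (by linarith [ha.2, hc.1]) (by linarith)
    obtain ⟨j, hj⟩ := hex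
    obtain ⟨k1, k2, k3⟩ := key _ _ _ (hl j) (hl (j + 1)) (hl (j + 2)) hj
    have k1' := hpi _ _ _ (hs (j + 1)) (hs (j + 2)) k1
    have k2' := hzero _ _ _ (hs (j + 2)) (hs j) k2
    have k3' := hzero _ _ _ (hs j) (hs (j + 1)) k3
    fin_cases j <;> fin_cases i <;> first
      | exact Or.inr k1'
      | exact Or.inl k2'
      | exact Or.inl k3'
  · right
    have hsum' : 2 * Real.pi ≤ l i + l (i + 1) + l (i + 2) := by
      revert i
      exact forall_fin_three_cyclic (P := fun a b c => 2 * Real.pi ≤ a + b + c).2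
        ⟨by linarith, by linarith, by linarith⟩
    refine hpi _ _ _ (hs (i + 1)) (hs (i + 2)) ?_
    rw [← Real.cos_two_pi_sub (l (i + 1) + l (i + 2))]
    exact Real.cos_le_cos_of_nonneg_of_le_pi (by linarith [(hl (i + 1)).2, (hl (i + 2)).2])
      (hl i).2.le (by linarith)

/-- The difference of the two sides is sin a sin b / sin(a+b) times (x cot a - y cot b)² + (x + y)².
-/
theorem cot_add_le {a b : ℝ} (ha : a ∈ Ioo 0 Real.pi) (hb : b ∈ Ioo 0 Real.pi)
    (hab : a + b ∈ Ioo 0 Real.pi) (x y : ℝ) :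
    Real.cos (a + b) / Real.sin (a + b) * (x + y) ^ 2 ≤
      Real.cos a / Real.sin a * x ^ 2 + Real.cos b / Real.sin b * y ^ 2 := by
  have h1 := Real.sin_pos_of_mem_Ioo ha
  have h2 := Real.sin_pos_of_mem_Ioo hb
  have h3 := Real.sin_pos_of_mem_Ioo hab
  have hid : Real.cos a / Real.sin a * x ^ 2 + Real.cos b / Real.sin b * y ^ 2 -
      Real.cos (a + b) / Real.sin (a + b) * (x + y) ^ 2 =
      Real.sin a * Real.sin b * ((Real.cos a / Real.sin a * x - Real.cos b / Real.sin b * y) ^ 2 +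
        (x + y) ^ 2) / Real.sin (a + b) := by
    rw [Real.sin_add] at h3
    rw [Real.cos_add, Real.sin_add]
    field_simp
    ring
  have : 0 ≤ Real.sin a * Real.sin b * ((Real.cos a / Real.sin a * x -
      Real.cos b / Real.sin b * y) ^ 2 + (x + y) ^ 2) / Real.sin (a + b) := by positivity
  linarith

theorem isOpen_spherical : IsOpen {l : Fin 3 → ℝ | spherical.IsTriangle l} := by
  have h : {l : Fin 3 → ℝ | spherical.IsTriangle l} =
      {l | (∀ i, 0 < l i) ∧ ∀ i, l i < l (i + 1) + l (i + 2)} ∩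
      ((⋂ i, {l | l i < Real.pi}) ∩ {l | l 0 + l 1 + l 2 < 2 * Real.pi}) := by
    ext l
    simp [IsTriangle, and_assoc]
  rw [h]
  refine isOpen_strict_triangle.inter ((isOpen_iInter_of_finite fun i => ?_).inter ?_)
  · exact isOpen_lt (continuous_apply i) continuous_const
  · exact isOpen_lt (by fun_prop) continuous_const

theorem isAngleModel_spherical :
    IsAngleModel (Ioo 0 Real.pi) Real.sin spherical.angle {l | spherical.IsTriangle l} {0} where
  ordConnected := ordConnected_Ioo
  continuousOn := Real.continuousOn_sin
  pos _ ht := Real.sin_pos_of_mem_Ioo ht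
  mem l hl i := IsTriangle.mem_Ioo hl i
  isOpen := isOpen_spherical
  continuousAt_angle _ hl i := continuousAt_spherical_angle hl i
  angle_mem l hl i := by
    obtain ⟨P, hP, -, hPsq⟩ := spherical_exists_gram hl
    have h1 := Real.sin_pos_of_mem_Ioo (IsTriangle.mem_Ioo hl (i + 1))
    have h2 := Real.sin_pos_of_mem_Ioo (IsTriangle.mem_Ioo hl (i + 2))
    obtain ⟨h3, h4, -⟩ := arccos_div_of_sq (by positivity) hP (hPsq i)
    exact arccos_mem_Ioo h3 h4
  angle_degenerate _ hl hlD i := spherical_angle_degenerate hl hlD i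
  sine_law l hl := by
    obtain ⟨P, hP, -, hPsq⟩ := spherical_exists_gram hl
    have hs : ∀ i, 0 < Real.sin (l i) := fun i =>
      Real.sin_pos_of_mem_Ioo (IsTriangle.mem_Ioo hl i)
    have h0 := hs 0
    have h1 := hs 1
    have h2 := hs 2
    refine ⟨P / (Real.sin (l 0) * Real.sin (l 1) * Real.sin (l 2)), by positivity, fun i => ?_⟩
    refine (arccos_div_of_sq (mul_pos (hs _) (hs _)) hP (hPsq i)).2.2.trans ?_
    refine forall_fin_three_cyclic (P := fun a b c => P / (Real.sin b * Real.sin c) =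
      P / (Real.sin (l 0) * Real.sin (l 1) * Real.sin (l 2)) * Real.sin a).2 ⟨?_, ?_, ?_⟩ i <;>
    field_simp
  variation l z s hs hd := by
    obtain ⟨P, hP, hP0, hPsq⟩ := spherical_exists_gram hs
    have hsin : ∀ i, 0 < Real.sin (l s i) := fun i =>
      Real.sin_pos_of_mem_Ioo (IsTriangle.mem_Ioo hs i)
    refine ⟨_, fun i => hasDerivAt_spherical_angle (hd i) (hd (i + 1)) (hd (i + 2)) (hsin _)
      (hsin _) hP (hPsq i), ?_⟩
    simp only [Fin.sum_univ_three, Fin.isValue, Fin.reduceAdd, zero_add]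
    -- The matrix is the adjugate of the Gram matrix with diagonal 1 and off-diagonal entries cos
    -- l_i, whose determinant is P². Hence the second minor is P² and the determinant is P⁴.
    have hform := ternary_form_pos (a := Real.sin (l s 0) ^ 2) (b := Real.sin (l s 1) ^ 2)
      (c := Real.sin (l s 2) ^ 2) (d := Real.cos (l s 0) * Real.cos (l s 1) - Real.cos (l s 2))
      (e := Real.cos (l s 0) * Real.cos (l s 2) - Real.cos (l s 1))
      (f := Real.cos (l s 1) * Real.cos (l s 2) - Real.cos (l s 0)) (pow_pos (hsin 0) 2)
      (by
        refine lt_of_lt_of_eq (pow_pos hP 2) ?_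
        rw [hP0, Real.sin_sq, Real.sin_sq]; ring)
      (by
        refine lt_of_lt_of_eq (pow_pos (pow_pos hP 2) 2) ?_
        rw [hP0, Real.sin_sq, Real.sin_sq, Real.sin_sq]; ring) (z 0) (z 1) (z 2)
    refine ⟨(div_nonneg hform.1 hP.le).trans_eq (by field_simp; ring), fun h => ?_⟩
    have h3 := hform.2 (by
      have : ∀ q r : ℝ, r = 0 → q = P * r → q = 0 := fun q r h1 h2 => by rw [h2, h1, mul_zero]
      refine this _ _ h ?_
      field_simp
      ring)
    refine funext fun i => ?_
    fin_cases i
    exacts [h3.1, h3.2.1, h3.2.2]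
  path_mem p hp l v hl h0 h1 s hs := by
    have hd : ∀ t ∈ Ioo 0 Real.pi, HasDerivAt Real.sin (Real.cos t) t := fun t _ =>
      Real.hasDerivAt_sin t
    have hpos : ∀ t ∈ Ioo 0 Real.pi, 0 < Real.sin t := fun t ht => Real.sin_pos_of_mem_Ioo ht
    have hκ : ∀ a ∈ Ioo 0 Real.pi, ∀ b ∈ Ioo 0 Real.pi, a + b ∈ Ioo 0 Real.pi → ∀ x y : ℝ,
        Real.cos (a + b) / Real.sin (a + b) * (x + y) ^ 2 ≤
          Real.cos a / Real.sin a * x ^ 2 + Real.cos b / Real.sin b * y ^ 2 :=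
      fun a ha b hb hab x y => cot_add_le ha hb hab x y
    refine ⟨fun i => (hl s hs i).1.1, strict_triangle_of_path ordConnected_Ioo isOpen_Ioo
      (fun t ht => ht.1) hd hpos hκ hp hl h0.2.1 h1.2.1 s hs, fun i => (hl s hs i).1.2, ?_⟩
    -- The perimeter bound reads l_2 < (π - l_0) + (π - l_1). Reflection in π/2 preserves the sine
    -- and only reverses the velocity, so the same path lemma applies.
    have hrefl : ∀ i, ∀ s ∈ Icc (0 : ℝ) 1, Real.pi - l s i ∈ Ioo 0 Real.pi ∧
        HasDerivAt (fun t => Real.pi - l t i) (-v i * Real.sin (Real.pi - l s i) ^ (-p)) s := by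
      intro i s hs
      obtain ⟨⟨m1, m2⟩, m3⟩ := hl s hs i
      refine ⟨⟨by linarith, by linarith⟩, ?_⟩
      rw [Real.sin_pi_sub, neg_mul]
      exact m3.const_sub _
    have := lt_add_of_path ordConnected_Ioo isOpen_Ioo (fun t ht => ht.1) hd hpos hκ hp (hrefl 0)
      (hrefl 1) (fun s hs => hl s hs 2) (by linarith [h0.2.2.2]) (by linarith [h1.2.2.2]) s hs
    linarith

end PlaneGeometry

/-! ### Hyperbolic triangles -/

namespace PlaneGeometry

theorem hyperbolic_gram_pos {a b c : ℝ} (ha : 0 < a) (hb : 0 < b) (hc : 0 < c) (h1 : a < b + c)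
    (h2 : b < c + a) (h3 : c < a + b) :
    0 < 1 - Real.cosh a ^ 2 - Real.cosh b ^ 2 - Real.cosh c ^ 2 +
      2 * Real.cosh a * Real.cosh b * Real.cosh c := by
  have k1 : Real.cosh a < Real.cosh (b + c) :=
    Real.cosh_lt_cosh.2 (by rw [abs_of_pos ha, abs_of_pos (by linarith)]; exact h1)
  have k2 : Real.cosh (b - c) < Real.cosh a :=
    Real.cosh_lt_cosh.2 (by
      rw [abs_of_pos ha]; exact abs_lt.2 ⟨by linarith, by linarith⟩)
  have k3 := mul_pos (sub_pos.2 k1) (sub_pos.2 k2)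
  rw [Real.cosh_add, Real.cosh_sub] at k3
  have eb := Real.sinh_sq b
  have ec := Real.sinh_sq c
  have : (Real.cosh b * Real.cosh c + Real.sinh b * Real.sinh c - Real.cosh a) *
      (Real.cosh a - (Real.cosh b * Real.cosh c - Real.sinh b * Real.sinh c)) =
      1 - Real.cosh a ^ 2 - Real.cosh b ^ 2 - Real.cosh c ^ 2 +
      2 * Real.cosh a * Real.cosh b * Real.cosh c := by
    linear_combination (Real.cosh c ^ 2 - 1) * eb + Real.sinh b ^ 2 * ec
  rwa [this] at k3

theorem hyperbolic_exists_gram {l : Fin 3 → ℝ} (hl : hyperbolic.IsTriangle l) :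
    ∃ P, 0 < P ∧ P ^ 2 = 1 - Real.cosh (l 0) ^ 2 - Real.cosh (l 1) ^ 2 - Real.cosh (l 2) ^ 2 +
      2 * Real.cosh (l 0) * Real.cosh (l 1) * Real.cosh (l 2) ∧
      ∀ i, P ^ 2 = (Real.sinh (l (i + 1)) * Real.sinh (l (i + 2))) ^ 2 -
      (Real.cosh (l (i + 1)) * Real.cosh (l (i + 2)) - Real.cosh (l i)) ^ 2 := by
  have h := hyperbolic_gram_pos (hl.1 0) (hl.1 1) (hl.1 2) (hl.2.1 0) (hl.2.1 1) (hl.2.1 2)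
  refine ⟨_, Real.sqrt_pos.2 h, Real.sq_sqrt h.le, ?_⟩
  rw [Real.sq_sqrt h.le]
  refine forall_fin_three_cyclic (P := fun a b c => _ = (Real.sinh b * Real.sinh c) ^ 2 -
    (Real.cosh b * Real.cosh c - Real.cosh a) ^ 2).2 ⟨?_, ?_, ?_⟩ <;>
  · simp only [mul_pow, Real.sinh_sq]; ring

theorem hasDerivAt_hyperbolic_angle {a b c : ℝ → ℝ} {x y z s P : ℝ}
    (ha : HasDerivAt a (Real.sinh (a s) * x) s) (hb : HasDerivAt b (Real.sinh (b s) * y) s)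
    (hc : HasDerivAt c (Real.sinh (c s) * z) s)
    (hb0 : 0 < Real.sinh (b s)) (hc0 : 0 < Real.sinh (c s)) (hP : 0 < P)
    (hPsq : P ^ 2 = (Real.sinh (b s) * Real.sinh (c s)) ^ 2 -
      (Real.cosh (b s) * Real.cosh (c s) - Real.cosh (a s)) ^ 2) :
    HasDerivAt (fun t => Real.arccos ((Real.cosh (b t) * Real.cosh (c t) - Real.cosh (a t)) /
        (Real.sinh (b t) * Real.sinh (c t))))
      (((Real.cosh (a s) ^ 2 - 1) * x + (Real.cosh (c s) - Real.cosh (a s) * Real.cosh (b s)) * y +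
        (Real.cosh (b s) - Real.cosh (a s) * Real.cosh (c s)) * z) / P) s := by
  have hN := (hb.cosh.fun_mul hc.cosh).fun_sub ha.cosh
  have hm := hb.sinh.fun_mul hc.sinh
  refine (hasDerivAt_arccos_div hN hm (by positivity) hP hPsq).congr_deriv ?_
  have ea := Real.sinh_sq (a s)
  have eb := Real.sinh_sq (b s)
  have ec := Real.sinh_sq (c s)
  rw [div_eq_div_iff (by positivity) hP.ne']
  linear_combination (Real.sinh (b s) * Real.sinh (c s) * P) * (x * ea - Real.cosh (c s) * y * eb
    - Real.cosh (b s) * z * ec)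

theorem continuousAt_hyperbolic_angle {l : Fin 3 → ℝ} (hl : ∀ i, 0 < l i) (i : Fin 3) :
    ContinuousAt (fun l => hyperbolic.angle l i) l := by
  have h1 := Real.sinh_pos_iff.2 (hl (i + 1))
  have h2 := Real.sinh_pos_iff.2 (hl (i + 2))
  refine Real.continuous_arccos.continuousAt.comp (ContinuousAt.div ?_ ?_ ?_)
  · have hc := Real.continuous_cosh
    fun_prop
  · have hs := Real.continuous_sinh
    fun_prop
  · positivity

theorem hyperbolic_angle_degenerate {l : Fin 3 → ℝ} (hl : ∀ i, 0 < l i)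
    (hlD : ¬ hyperbolic.IsTriangle l) :
    ∃ j, hyperbolic.angle l j = Real.pi ∧ hyperbolic.angle l (j + 1) = 0 ∧
      hyperbolic.angle l (j + 2) = 0 := by
  have hex : ∃ j, l (j + 1) + l (j + 2) ≤ l j := by
    by_contra! hall
    exact hlD ⟨hl, hall, trivial⟩
  have key : ∀ a b c : ℝ, 0 < a → 0 < b → 0 < c → b + c ≤ a →
      Real.arccos ((Real.cosh b * Real.cosh c - Real.cosh a) / (Real.sinh b * Real.sinh c)) =
        Real.pi ∧
      Real.arccos ((Real.cosh c * Real.cosh a - Real.cosh b) / (Real.sinh c * Real.sinh a)) = 0 ∧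
      Real.arccos ((Real.cosh a * Real.cosh b - Real.cosh c) / (Real.sinh a * Real.sinh b)) = 0 := by
    intro a b c ha hb hc h
    have sa := Real.sinh_pos_iff.2 ha
    have sb := Real.sinh_pos_iff.2 hb
    have sc := Real.sinh_pos_iff.2 hc
    refine ⟨arccos_div_eq_pi (mul_pos sb sc) ?_, arccos_div_eq_zero (mul_pos sc sa) ?_,
      arccos_div_eq_zero (mul_pos sa sb) ?_⟩
    · have : Real.cosh (b + c) ≤ Real.cosh a :=
        Real.cosh_le_cosh.2 (by rw [abs_of_pos ha, abs_of_pos (by linarith)]; exact h)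
      rw [Real.cosh_add] at this; linarith
    · have : Real.cosh b ≤ Real.cosh (a - c) :=
        Real.cosh_le_cosh.2 (by rw [abs_of_pos hb, abs_of_pos (by linarith)]; linarith)
      rw [Real.cosh_sub] at this; linarith
    · have : Real.cosh c ≤ Real.cosh (a - b) :=
        Real.cosh_le_cosh.2 (by rw [abs_of_pos hc, abs_of_pos (by linarith)]; linarith)
      rw [Real.cosh_sub] at this; linarith
  obtain ⟨j, hj⟩ := hex
  obtain ⟨k1, k2, k3⟩ := key _ _ _ (hl j) (hl (j + 1)) (hl (j + 2)) hj
  refine ⟨j, k1, ?_, ?_⟩ <;> fin_cases j <;> first | exact k2 | exact k3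

/-- The angle `π/2 - (b + c - a)/2`. -/
noncomputable def coangle (K : PlaneGeometry) (l : Fin 3 → ℝ) (i : Fin 3) : ℝ :=
  Real.pi / 2 - (K.angle l (i + 1) + K.angle l (i + 2) - K.angle l i) / 2

/-- With `A, B, C` the hyperbolic cosines of the sides, this evaluates
`cos ((β + γ - α) / 2) ^ 2` for the angles of a hyperbolic triangle. -/
theorem cos_half_sq {A B C x y z P α β γ : ℝ} (hx : 0 < x) (hy : 0 < y) (hz : 0 < z)
    (ex : x ^ 2 = A ^ 2 - 1) (ey : y ^ 2 = B ^ 2 - 1) (ez : z ^ 2 = C ^ 2 - 1)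
    (hA : 1 < A) (hB : 1 < B) (hC : 1 < C)
    (hP : P ^ 2 = 1 - A ^ 2 - B ^ 2 - C ^ 2 + 2 * A * B * C)
    (ca : Real.cos α = (B * C - A) / (y * z)) (sa : Real.sin α = P / (y * z))
    (cb : Real.cos β = (C * A - B) / (z * x)) (sb : Real.sin β = P / (z * x))
    (cc : Real.cos γ = (A * B - C) / (x * y)) (sc : Real.sin γ = P / (x * y)) :
    Real.cos ((β + γ - α) / 2) ^ 2 =
      P ^ 2 / (2 * (A - 1) * (B - 1) * (C - 1)) * (x / (1 + A)) ^ 2 := by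
  have hA' : 0 < A - 1 := by linarith
  have hB' : 0 < B - 1 := by linarith
  have hC' : 0 < C - 1 := by linarith
  have hA1 : 0 < 1 + A := by linarith
  have e1 : Real.cos (β + γ - α) = ((B * C - A) * (C * A - B) * (A * B - C) + P ^ 2 *
      ((C * A - B) + (A * B - C) - (B * C - A))) / (x ^ 2 * y ^ 2 * z ^ 2) := by
    rw [Real.cos_sub, Real.cos_add, Real.sin_add, ca, cb, cc, sa, sb, sc]
    field_simp
    ring
  rw [Real.cos_sq, show 2 * ((β + γ - α) / 2) = β + γ - α by ring, e1, div_pow x, ex, ey, ez, hP,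
    show A ^ 2 - 1 = (A - 1) * (1 + A) by ring, show B ^ 2 - 1 = (B - 1) * (1 + B) by ring,
    show C ^ 2 - 1 = (C - 1) * (1 + C) by ring]
  have hB1 : 0 < 1 + B := by linarith
  have hC1 : 0 < 1 + C := by linarith
  field_simp
  ring

/-- The sum equals (A - 1) P² / (x² y z). Its positivity makes the angle sum less than π. -/
theorem cos_add_add_cos_pos {A B C x y z P α β γ : ℝ} (hx : 0 < x) (hy : 0 < y) (hz : 0 < z)
    (ex : x ^ 2 = A ^ 2 - 1) (hA : 1 < A) (hP0 : 0 < P)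
    (hP : P ^ 2 = 1 - A ^ 2 - B ^ 2 - C ^ 2 + 2 * A * B * C)
    (ca : Real.cos α = (B * C - A) / (y * z))
    (cb : Real.cos β = (C * A - B) / (z * x)) (sb : Real.sin β = P / (z * x))
    (cc : Real.cos γ = (A * B - C) / (x * y)) (sc : Real.sin γ = P / (x * y)) :
    0 < Real.cos (β + γ) + Real.cos α := by
  have h : 0 < (A - 1) * P ^ 2 / (x ^ 2 * y * z) :=
    div_pos (mul_pos (by linarith) (by positivity)) (by positivity)
  refine h.trans_eq ?_
  rw [Real.cos_add, ca, cb, cc, sb, sc]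
  field_simp
  rw [ex, hP]
  ring

/-- The angles of a hyperbolic triangle in terms of the Gram determinant. -/
theorem hyperbolic_cos_sin_angle {l : Fin 3 → ℝ} (hl : hyperbolic.IsTriangle l) {P : ℝ} (hP : 0 < P)
    (i : Fin 3) (hPsq : P ^ 2 = (Real.sinh (l (i + 1)) * Real.sinh (l (i + 2))) ^ 2 -
      (Real.cosh (l (i + 1)) * Real.cosh (l (i + 2)) - Real.cosh (l i)) ^ 2) :
    hyperbolic.angle l i ∈ Ioo 0 Real.pi ∧
    Real.cos (hyperbolic.angle l i) = (Real.cosh (l (i + 1)) * Real.cosh (l (i + 2)) -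
      Real.cosh (l i)) / (Real.sinh (l (i + 1)) * Real.sinh (l (i + 2))) ∧
    Real.sin (hyperbolic.angle l i) = P / (Real.sinh (l (i + 1)) * Real.sinh (l (i + 2))) := by
  obtain ⟨h1, h2, h3⟩ := arccos_div_of_sq (mul_pos (Real.sinh_pos_iff.2 (hl.1 (i + 1)))
    (Real.sinh_pos_iff.2 (hl.1 (i + 2)))) hP hPsq
  exact ⟨arccos_mem_Ioo h1 h2, Real.cos_arccos h1.le h2.le, h3⟩

theorem hyperbolic_angle_sum_lt {l : Fin 3 → ℝ} (hl : hyperbolic.IsTriangle l) :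
    hyperbolic.angle l 0 + hyperbolic.angle l 1 + hyperbolic.angle l 2 < Real.pi := by
  obtain ⟨P, hP, hP0, hPsq⟩ := hyperbolic_exists_gram hl
  have hs : ∀ i, 0 < Real.sinh (l i) := fun i => Real.sinh_pos_iff.2 (hl.1 i)
  have hc : ∀ i, 1 < Real.cosh (l i) := fun i => Real.one_lt_cosh.2 (hl.1 i).ne'
  obtain ⟨m0, c0, s0⟩ := hyperbolic_cos_sin_angle hl hP 0 (hPsq 0)
  obtain ⟨m1, c1, s1⟩ := hyperbolic_cos_sin_angle hl hP 1 (hPsq 1)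
  obtain ⟨m2, c2, s2⟩ := hyperbolic_cos_sin_angle hl hP 2 (hPsq 2)
  exact angle_sum_lt_pi m0 m1 m2
    (cos_add_add_cos_pos (hs 0) (hs 1) (hs 2) (Real.sinh_sq _) (hc 0) hP hP0 c0 c1 s1 c2 s2)
    (cos_add_add_cos_pos (B := Real.cosh (l 2)) (C := Real.cosh (l 0)) (hs 1) (hs 2) (hs 0)
      (Real.sinh_sq _) (hc 1) hP (by rw [hP0]; ring) c1 c2 s2 c0 s0)

theorem hyperbolic_coangle_mem {l : Fin 3 → ℝ} (hl : hyperbolic.IsTriangle l) (i : Fin 3) :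
    hyperbolic.coangle l i ∈ Ioo 0 Real.pi := by
  obtain ⟨P, hP, -, hPsq⟩ := hyperbolic_exists_gram hl
  have hm := fun i => (hyperbolic_cos_sin_angle hl hP i (hPsq i)).1
  have hsum := hyperbolic_angle_sum_lt hl
  have hsum' : hyperbolic.angle l i + hyperbolic.angle l (i + 1) + hyperbolic.angle l (i + 2) <
      Real.pi := by
    revert i
    exact (forall_fin_three_cyclic (l := hyperbolic.angle l)
      (P := fun a b c => a + b + c < Real.pi)).2 ⟨by linarith, by linarith, by linarith⟩
  obtain ⟨a1, a2⟩ := hm i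
  obtain ⟨b1, b2⟩ := hm (i + 1)
  obtain ⟨c1, c2⟩ := hm (i + 2)
  constructor <;> simp only [coangle] <;> linarith

/-- The function on the right is tanh(l/2). By `cos_half_sq` the squares of the two sides are
proportional with a factor symmetric in the three lengths; k is its square root, and both sides are
positive. -/
theorem hyperbolic_sine_law {l : Fin 3 → ℝ} (hl : hyperbolic.IsTriangle l) :
    ∃ k, 0 < k ∧ ∀ i, Real.sin (hyperbolic.coangle l i) =
      k * (Real.sinh (l i) / (1 + Real.cosh (l i))) := by
  obtain ⟨P, hP, hP0, hPsq⟩ := hyperbolic_exists_gram hl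
  have hs : ∀ i, 0 < Real.sinh (l i) := fun i => Real.sinh_pos_iff.2 (hl.1 i)
  have hc : ∀ i, 1 < Real.cosh (l i) := fun i => Real.one_lt_cosh.2 (hl.1 i).ne'
  have hc' : ∀ i, 0 < Real.cosh (l i) - 1 := fun i => sub_pos.2 (hc i)
  have hc1 : ∀ i, 0 < 1 + Real.cosh (l i) := fun i => by linarith [hc i]
  have hR : 0 < P ^ 2 / (2 * (Real.cosh (l 0) - 1) * (Real.cosh (l 1) - 1) *
      (Real.cosh (l 2) - 1)) :=
    div_pos (by positivity) (mul_pos (mul_pos (mul_pos two_pos (hc' 0)) (hc' 1)) (hc' 2))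
  refine ⟨_, Real.sqrt_pos.2 hR, fun i => ?_⟩
  have hpos := Real.sin_pos_of_mem_Ioo (hyperbolic_coangle_mem hl i)
  refine (sq_eq_sq₀ hpos.le (mul_nonneg (Real.sqrt_nonneg _) (div_pos (hs i) (hc1 i)).le)).1 ?_
  rw [mul_pow, Real.sq_sqrt hR.le, coangle, Real.sin_pi_div_two_sub]
  clear hpos
  obtain ⟨-, c0, s0⟩ := hyperbolic_cos_sin_angle hl hP 0 (hPsq 0)
  obtain ⟨-, c1, s1⟩ := hyperbolic_cos_sin_angle hl hP 1 (hPsq 1)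
  obtain ⟨-, c2, s2⟩ := hyperbolic_cos_sin_angle hl hP 2 (hPsq 2)
  fin_cases i
  · exact cos_half_sq (hs 0) (hs 1) (hs 2) (Real.sinh_sq _) (Real.sinh_sq _) (Real.sinh_sq _)
      (hc 0) (hc 1) (hc 2) hP0 c0 s0 c1 s1 c2 s2
  · refine (cos_half_sq (hs 1) (hs 2) (hs 0) (Real.sinh_sq _) (Real.sinh_sq _) (Real.sinh_sq _)
      (hc 1) (hc 2) (hc 0) (by rw [hP0]; ring) c1 s1 c2 s2 c0 s0).trans ?_
    congr 2; ring
  · refine (cos_half_sq (hs 2) (hs 0) (hs 1) (Real.sinh_sq _) (Real.sinh_sq _) (Real.sinh_sq _)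
      (hc 2) (hc 0) (hc 1) (by rw [hP0]; ring) c2 s2 c0 s0 c1 s1).trans ?_
    congr 2; ring

theorem hyperbolic_variation {l : ℝ → Fin 3 → ℝ} {z : Fin 3 → ℝ} {s : ℝ}
    (hs : hyperbolic.IsTriangle (l s))
    (hd : ∀ i, HasDerivAt (fun t => l t i)
      (Real.sinh (l s i) / (1 + Real.cosh (l s i)) * z i) s) :
    ∃ α' : Fin 3 → ℝ, (∀ i, HasDerivAt (fun t => hyperbolic.coangle (l t) i) (α' i) s) ∧
      0 ≤ ∑ i, α' i * z i ∧ (∑ i, α' i * z i = 0 → z = 0) := by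
  obtain ⟨P, hP, hP0, hPsq⟩ := hyperbolic_exists_gram hs
  have hsinh : ∀ i, 0 < Real.sinh (l s i) := fun i => Real.sinh_pos_iff.2 (hs.1 i)
  have hd' : ∀ i, HasDerivAt (fun t => l t i)
      (Real.sinh (l s i) * (z i / (1 + Real.cosh (l s i)))) s := fun i =>
    (hd i).congr_deriv (by ring)
  have hang := fun i => hasDerivAt_hyperbolic_angle (hd' i) (hd' (i + 1)) (hd' (i + 2)) (hsinh _)
      (hsinh _) hP (hPsq i)
  refine ⟨_, fun i => ((((hang (i + 1)).fun_add (hang (i + 2))).fun_sub (hang i)).div_const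
    2).const_sub (Real.pi / 2), ?_⟩
  simp only [Fin.sum_univ_three, Fin.isValue, Fin.reduceAdd, zero_add]
  have hA : 1 < Real.cosh (l s 0) := Real.one_lt_cosh.2 (hs.1 0).ne'
  have hB : 1 < Real.cosh (l s 1) := Real.one_lt_cosh.2 (hs.1 1).ne'
  have hC : 1 < Real.cosh (l s 2) := Real.one_lt_cosh.2 (hs.1 2).ne'
  generalize Real.cosh (l s 0) = A at *
  generalize Real.cosh (l s 1) = B at *
  generalize Real.cosh (l s 2) = C at *
  have hA1 : 0 < 1 + A := by linarith
  have hB1 : 0 < 1 + B := by linarith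
  have hC1 : 0 < 1 + C := by linarith
  -- This is the variation form multiplied by 2P. The second and third leading minors are positive
  -- multiples of P² and P⁴, where P² is the Gram expression in `hP0`.
  have hform := ternary_form_pos (a := (A - 1) / (1 + A) * (1 + A + B + C))
    (b := (B - 1) / (1 + B) * (1 + A + B + C)) (c := (C - 1) / (1 + C) * (1 + A + B + C))
    (d := 1 + C - A - B) (e := 1 + B - A - C) (f := 1 + A - B - C)
    (mul_pos (div_pos (by linarith) hA1) (by linarith))
    (by
      have : 0 < 2 * (A + B) * P ^ 2 / ((1 + A) * (1 + B)) :=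
        div_pos (mul_pos (by linarith) (by positivity)) (by positivity)
      refine this.trans_eq ?_
      rw [hP0]; field_simp; ring)
    (by
      have : 0 < 4 * (P ^ 2) ^ 2 / ((1 + A) * (1 + B) * (1 + C)) := by positivity
      refine this.trans_eq ?_
      rw [hP0]; field_simp; ring) (z 0) (z 1) (z 2)
  set Q := (A - 1) / (1 + A) * (1 + A + B + C) * z 0 ^ 2 +
    (B - 1) / (1 + B) * (1 + A + B + C) * z 1 ^ 2 +
    (C - 1) / (1 + C) * (1 + A + B + C) * z 2 ^ 2 + 2 * (1 + C - A - B) * z 0 * z 1 +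
    2 * (1 + B - A - C) * z 0 * z 2 + 2 * (1 + A - B - C) * z 1 * z 2 with hQ
  have hid : ∀ q : ℝ, q = Q / (2 * P) → 0 ≤ q ∧ (q = 0 → z = 0) := by
    rintro q rfl
    refine ⟨div_nonneg hform.1 (by positivity), fun h => ?_⟩
    have h3 := hform.2 (by
      rcases div_eq_zero_iff.1 h with h | h
      · exact h
      · exact absurd h (by positivity))
    refine funext fun i => ?_
    fin_cases i
    exacts [h3.1, h3.2.1, h3.2.2]
  apply hid
  rw [hQ]
  field_simp
  ring

theorem hasDerivAt_sinh_div_one_add_cosh (t : ℝ) :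
    HasDerivAt (fun t => Real.sinh t / (1 + Real.cosh t)) (1 / (1 + Real.cosh t)) t := by
  have h : 0 < 1 + Real.cosh t := by positivity
  refine ((Real.hasDerivAt_sinh t).div ((Real.hasDerivAt_cosh t).const_add 1) h.ne').congr_deriv ?_
  have := Real.sinh_sq t
  field_simp
  linear_combination -this

/-- The logarithmic derivative of tanh(t/2) is 1/sinh t. Superadditivity of sinh reduces the claim
to the Cauchy–Schwarz inequality. -/
theorem inv_sinh_add_le {a b : ℝ} (ha : 0 < a) (hb : 0 < b) (x y : ℝ) :
    1 / Real.sinh (a + b) * (x + y) ^ 2 ≤ 1 / Real.sinh a * x ^ 2 + 1 / Real.sinh b * y ^ 2 := by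
  have h1 := Real.sinh_pos_iff.2 ha
  have h2 := Real.sinh_pos_iff.2 hb
  have h3 : Real.sinh a + Real.sinh b ≤ Real.sinh (a + b) := by
    rw [Real.sinh_add]
    nlinarith [Real.one_le_cosh a, Real.one_le_cosh b]
  have h4 : 1 / Real.sinh (a + b) * (x + y) ^ 2 ≤
      1 / (Real.sinh a + Real.sinh b) * (x + y) ^ 2 := by gcongr
  have hid : 1 / Real.sinh a * x ^ 2 + 1 / Real.sinh b * y ^ 2 -
      1 / (Real.sinh a + Real.sinh b) * (x + y) ^ 2 =
      (Real.sinh b * x - Real.sinh a * y) ^ 2 /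
        (Real.sinh a * Real.sinh b * (Real.sinh a + Real.sinh b)) := by
    field_simp; ring
  have : 0 ≤ (Real.sinh b * x - Real.sinh a * y) ^ 2 /
      (Real.sinh a * Real.sinh b * (Real.sinh a + Real.sinh b)) := by positivity
  linarith

theorem isAngleModel_hyperbolic :
    IsAngleModel (Ioi 0) (fun t => Real.sinh t / (1 + Real.cosh t)) hyperbolic.coangle
      {l | hyperbolic.IsTriangle l} {0} where
  ordConnected := ordConnected_Ioi
  continuousOn t _ := (hasDerivAt_sinh_div_one_add_cosh t).continuousAt.continuousWithinAt
  pos _ ht := div_pos (Real.sinh_pos_iff.2 ht) (by positivity)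
  mem l hl i := hl.1 i
  isOpen := by
    simpa only [IsTriangle, and_true] using isOpen_strict_triangle
  continuousAt_angle _ hl i := by
    have h := continuousAt_hyperbolic_angle hl
    exact continuousAt_const.sub ((((h (i + 1)).add (h (i + 2))).sub (h i)).div_const 2)
  angle_mem _ hl i := hyperbolic_coangle_mem hl i
  angle_degenerate l hl hlD i := by
    obtain ⟨j, h1, h2, h3⟩ := hyperbolic_angle_degenerate hl hlD
    have k1 : hyperbolic.coangle l j = Real.pi := by
      rw [coangle, h1, h2, h3]; ring
    have hj : ∀ j : Fin 3, j + 1 + 1 = j + 2 ∧ j + 1 + 2 = j ∧ j + 2 + 1 = j ∧ j + 2 + 2 = j + 1 ∧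
        ∀ i, i = j ∨ i = j + 1 ∨ i = j + 2 := by decide
    obtain ⟨e1, e2, e3, e4, e5⟩ := hj j
    have k2 : hyperbolic.coangle l (j + 1) = 0 := by
      rw [coangle, e1, e2, h1, h2, h3]; ring
    have k3 : hyperbolic.coangle l (j + 2) = 0 := by
      rw [coangle, e3, e4, h1, h2, h3]; ring
    rcases e5 i with rfl | rfl | rfl
    exacts [Or.inr k1, Or.inl k2, Or.inl k3]
  sine_law _ hl := hyperbolic_sine_law hl
  variation _ _ _ hs hd := hyperbolic_variation hs hd
  path_mem p hp l v hl h0 h1 s hs := by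
    refine ⟨fun i => (hl s hs i).1, strict_triangle_of_path ordConnected_Ioi isOpen_Ioi
      subset_rfl (f' := fun t => 1 / (1 + Real.cosh t))
      (fun t _ => hasDerivAt_sinh_div_one_add_cosh t)
      (fun t ht => div_pos (Real.sinh_pos_iff.2 ht) (by positivity)) ?_ hp hl
      h0.2.1 h1.2.1 s hs, trivial⟩
    intro a ha b hb hab x y
    have hrw : ∀ t ∈ Ioi (0 : ℝ), 1 / (1 + Real.cosh t) / (Real.sinh t / (1 + Real.cosh t)) =
        1 / Real.sinh t := fun t ht => by
      have := Real.sinh_pos_iff.2 (mem_Ioi.1 ht)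
      field_simp
    rw [hrw a ha, hrw b hb, hrw _ hab]
    exact inv_sinh_add_le ha hb x y

end PlaneGeometry

/-! ### Euclidean angle sum and scaling -/

namespace PlaneGeometry

theorem euclidean_angle_sum {l : Fin 3 → ℝ} (hl : euclidean.IsTriangle l) :
    euclidean.angle l 0 + euclidean.angle l 1 + euclidean.angle l 2 = Real.pi := by
  obtain ⟨P, hP, hPsq⟩ := euclidean_exists_area hl
  have hcs : ∀ i, Real.cos (euclidean.angle l i) =
        (l (i + 1) ^ 2 + l (i + 2) ^ 2 - l i ^ 2) / (2 * l (i + 1) * l (i + 2)) ∧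
      Real.sin (euclidean.angle l i) = P / (2 * l (i + 1) * l (i + 2)) := fun i => by
    have h1 := hl.1 (i + 1)
    have h2 := hl.1 (i + 2)
    obtain ⟨h3, h4, h5⟩ := arccos_div_of_sq (by positivity) hP (hPsq i)
    exact ⟨Real.cos_arccos h3.le h4.le, h5⟩
  have key : ∀ {a b c α β γ : ℝ}, 0 < a → 0 < b → 0 < c →
      P ^ 2 = (2 * b * c) ^ 2 - (b ^ 2 + c ^ 2 - a ^ 2) ^ 2 →
      Real.cos α = (b ^ 2 + c ^ 2 - a ^ 2) / (2 * b * c) →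
      Real.cos β = (c ^ 2 + a ^ 2 - b ^ 2) / (2 * c * a) → Real.sin β = P / (2 * c * a) →
      Real.cos γ = (a ^ 2 + b ^ 2 - c ^ 2) / (2 * a * b) → Real.sin γ = P / (2 * a * b) →
      Real.cos (β + γ) + Real.cos α = 0 := by
    intro a b c α β γ ha hb hc hP ca cb sb cc sc
    rw [Real.cos_add, ca, cb, cc, sb, sc]
    field_simp
    rw [hP]
    ring
  have hm := isAngleModel_euclidean.angle_mem l hl
  exact angle_sum_eq_pi (hm 0) (hm 1) (hm 2)
    (key (hl.1 0) (hl.1 1) (hl.1 2) (hPsq 0) (hcs 0).1 (hcs 1).1 (hcs 1).2 (hcs 2).1 (hcs 2).2)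
    (key (hl.1 1) (hl.1 2) (hl.1 0) (hPsq 1) (hcs 1).1 (hcs 2).1 (hcs 2).2 (hcs 0).1 (hcs 0).2)

/-- Angle sum π means (b+c-a)/2 = π/2 - a, which is why the two Euclidean curvatures coincide. -/
theorem euclidean_coangle {l : Fin 3 → ℝ} (hl : euclidean.IsTriangle l) (i : Fin 3) :
    euclidean.coangle l i = euclidean.angle l i := by
  have hsum := euclidean_angle_sum hl
  have hsum' : euclidean.angle l i + euclidean.angle l (i + 1) + euclidean.angle l (i + 2) =
      Real.pi := by
    revert i
    exact (forall_fin_three_cyclic (l := euclidean.angle l)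
      (P := fun a b c => a + b + c = Real.pi)).2 ⟨by linarith, by linarith, by linarith⟩
  rw [coangle]
  linarith

end PlaneGeometry

/-- The left side is an entry of the Euclidean kernel vector. It depends only on y/x, injectively,
so equal entries mean proportional triangles. -/
theorem integral_rpow_mul_rpow {x y : ℝ} (hx : 0 < x) (hy : 0 < y) (h : ℝ) :
    (∫ t in x..y, t ^ (-h - 1)) * x ^ h = ∫ t in (1 : ℝ)..(y / x), t ^ (-h - 1) := by
  have h1 := intervalIntegral.mul_integral_comp_mul_left (a := 1) (b := y / x) (c := x)
    (f := fun t => t ^ (-h - 1))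
  rw [mul_one, mul_div_cancel₀ y hx.ne'] at h1
  have h2 : ∫ t in (1 : ℝ)..(y / x), (x * t) ^ (-h - 1) =
      ∫ t in (1 : ℝ)..(y / x), x ^ (-h - 1) * t ^ (-h - 1) := by
    refine intervalIntegral.integral_congr fun t ht => ?_
    have ht0 : 0 < t := (ordConnected_Ioi.uIcc_subset (mem_Ioi.2 one_pos)
      (mem_Ioi.2 (div_pos hy hx))) ht
    exact Real.mul_rpow hx.le ht0.le
  rw [← h1, h2, intervalIntegral.integral_const_mul, sub_eq_add_neg, Real.rpow_add hx,
    Real.rpow_neg hx.le, Real.rpow_neg_one]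
  have hxh : 0 < x ^ h := Real.rpow_pos_of_pos hx h
  field_simp

/-! ### Curvatures in terms of angle models, and the theorem -/

namespace BorderedTriangulatedSurface

variable {F E : Type*} [Fintype F] [DecidableEq E]

theorem psiCurvature_eq (S : BorderedTriangulatedSurface F E) (K : PlaneGeometry) (h : ℝ)
    (d : E → ℝ) (e : E) : S.psiCurvature K h d e =
      ∑ s ∈ S.sides e, sinPowIntegral h (K.coangle (S.sideLengths d s.1) s.2) :=
  Finset.sum_congr rfl fun _ _ => integral_cos_rpow_eq_sinPowIntegral h _

theorem euclidean_psiCurvature_eq (S : BorderedTriangulatedSurface F E) (h : ℝ) {d : E → ℝ}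
    (hd : S.IsPolyhedralMetric PlaneGeometry.euclidean d) (e : E) :
    S.psiCurvature PlaneGeometry.euclidean h d e = S.phiCurvature PlaneGeometry.euclidean h d e := by
  rw [psiCurvature_eq]
  refine Finset.sum_congr rfl fun s _ => ?_
  rw [PlaneGeometry.euclidean_coangle (hd s.1)]
  rfl

theorem euclidean_rigidity (S : BorderedTriangulatedSurface F E) (h : ℝ) {d₁ d₂ : E → ℝ}
    (h₁ : S.IsPolyhedralMetric PlaneGeometry.euclidean d₁)
    (h₂ : S.IsPolyhedralMetric PlaneGeometry.euclidean d₂)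
    (hb : ∀ e, S.IsBoundaryEdge e → d₁ e = d₂ e)
    (hc : ∀ e, S.IsInteriorEdge e → S.phiCurvature PlaneGeometry.euclidean h d₁ e =
      S.phiCurvature PlaneGeometry.euclidean h d₂ e) : d₁ = d₂ := by
  have M := PlaneGeometry.isAngleModel_euclidean
  refine S.eq_of_proportional (fun e => ?_) (fun t => ?_) hb
  · obtain ⟨⟨t, i⟩, rfl⟩ := S.edge_surjective e
    exact (h₁ t).1 i
  · have hK := S.mem_kernel_of_curvature_eq M h h₁ h₂ hb hc t
    have hx := (h₁ t).1
    have hy := (h₂ t).1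
    have hr : ∀ i, 0 < S.sideLengths d₂ t i / S.sideLengths d₁ t i := fun i =>
      div_pos (hy i) (hx i)
    have hint : ∀ i, IntervalIntegrable (fun r : ℝ => r ^ (-h - 1)) MeasureTheory.volume 1
        (S.sideLengths d₂ t i / S.sideLengths d₁ t i) := fun i =>
      ((M.continuousOn_rpow (-h - 1)).mono
        (M.ordConnected.uIcc_subset (mem_Ioi.2 one_pos) (hr i))).intervalIntegrable
    have hratio : ∀ i, S.sideLengths d₂ t i / S.sideLengths d₁ t i =
        S.sideLengths d₂ t 0 / S.sideLengths d₁ t 0 := fun i => by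
      have h3 := hK i 0
      simp only [integral_rpow_mul_rpow (hx _) (hy _)] at h3
      refine (M.integral_eq_zero_iff (-h - 1) (hr i) (hr 0)).1 ?_
      rw [← intervalIntegral.integral_interval_sub_left (hint 0) (hint i), h3, sub_self]
    exact ⟨_, fun i => (div_eq_iff (hx i).ne').1 (hratio i)⟩

end BorderedTriangulatedSurface

theorem mainTheorem1 {F E : Type*} [Fintype F] [DecidableEq E]
    (S : BorderedTriangulatedSurface F E) (h : ℝ) :
    -- (a) Euclidean metrics, with the `φ_h`-curvature or with the `ψ_h`-curvature
    (∀ d₁ d₂ : E → ℝ,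
      S.IsPolyhedralMetric PlaneGeometry.euclidean d₁ →
      S.IsPolyhedralMetric PlaneGeometry.euclidean d₂ →
      (∀ e, S.IsBoundaryEdge e → d₁ e = d₂ e) →
      ((∀ e, S.IsInteriorEdge e →
          S.phiCurvature PlaneGeometry.euclidean h d₁ e =
            S.phiCurvature PlaneGeometry.euclidean h d₂ e) ∨
        (∀ e, S.IsInteriorEdge e →
          S.psiCurvature PlaneGeometry.euclidean h d₁ e =
            S.psiCurvature PlaneGeometry.euclidean h d₂ e)) →
      d₁ = d₂) ∧
    -- (b) hyperbolic metrics, with the `ψ_h`-curvature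
    (∀ d₁ d₂ : E → ℝ,
      S.IsPolyhedralMetric PlaneGeometry.hyperbolic d₁ →
      S.IsPolyhedralMetric PlaneGeometry.hyperbolic d₂ →
      (∀ e, S.IsBoundaryEdge e → d₁ e = d₂ e) →
      (∀ e, S.IsInteriorEdge e →
        S.psiCurvature PlaneGeometry.hyperbolic h d₁ e =
          S.psiCurvature PlaneGeometry.hyperbolic h d₂ e) →
      d₁ = d₂) ∧
    -- (c) spherical metrics, with the `φ_h`-curvature
    (∀ d₁ d₂ : E → ℝ,
      S.IsPolyhedralMetric PlaneGeometry.spherical d₁ →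
      S.IsPolyhedralMetric PlaneGeometry.spherical d₂ →
      (∀ e, S.IsBoundaryEdge e → d₁ e = d₂ e) →
      (∀ e, S.IsInteriorEdge e →
        S.phiCurvature PlaneGeometry.spherical h d₁ e =
          S.phiCurvature PlaneGeometry.spherical h d₂ e) →
      d₁ = d₂) := by
  refine ⟨fun d₁ d₂ h₁ h₂ hb hc => ?_, fun d₁ d₂ h₁ h₂ hb hc => ?_, fun d₁ d₂ h₁ h₂ hb hc => ?_⟩
  · refine S.euclidean_rigidity h h₁ h₂ hb fun e he => ?_
    rcases hc with hc | hc
    · exact hc e he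
    · rw [← S.euclidean_psiCurvature_eq h h₁, ← S.euclidean_psiCurvature_eq h h₂]
      exact hc e he
  · refine S.eq_of_curvature_eq PlaneGeometry.isAngleModel_hyperbolic h h₁ h₂ hb fun e he => ?_
    simpa only [S.psiCurvature_eq] using hc e he
  · exact S.eq_of_curvature_eq PlaneGeometry.isAngleModel_spherical h h₁ h₂ hb hc
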